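/- **Theorem (Generating function for the number of $x$-axis crossings).** Let $P(u)=\sum_i p_i u^i\in\mathbb{C}[u,1/u]$ encode a finite weighted step set: the jumps are the $i\in\mathbb{Z}$ with $p_i\neq 0$, and jump $i$ has weight $p_i$. Let $c\ge 0$ (resp. $d\ge 0$) be the largest amplitude of a downward (resp. upward) jump, with value $0$ if there is none. A walk of length $n$ is a sequence of $n$ jumps; it starts at altitude $y_0=0$ and has altitude $y_t$ after $t$ jumps; its weight is the product of the weights of its jumps. A crossing of the $x$-axis is a $t$ with $0<t<n$ such that $y_t>0>y_{t+1}$ or $y_t<0<y_{t+1}$. Let $w_{n,k,j}$ be the sum of the weights of the walks of length $n$ that end at altitude $k$ and have $j$ crossings (the number of such walks, if all weights are $1$), and let $$W(z,u,q)=\sum_{n,j\ge 0,\ k\in\mathbb{Z}} w_{n,k,j}\,z^n u^k q^j=\sum_{k\in\mathbb{Z}}W_k(z,q)\,u^k\ \in\ \mathbb{C}[q][u,1/u][[z]].$$ Write $\{u^{>0}\}$ and $\{u^{<0}\}$ for the operators that keep the terms of positive, respectively negative, degree in $u$. Then: 1. $W$ is algebraic over $\mathbb{C}(z,u,q)$.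 2. $W$ is determined by the $W_k$ with $-d<k<c$ through $$(1-zP(u))\,W=1-z(1-q)\Bigl(\sum_{k=-d+1}^{-1}\{u^{>0}\}(P(u)u^k)\,W_k+\sum_{k=1}^{c-1}\{u^{<0}\}(P(u)u^k)\,W_k\Bigr).$$ 3. The equation $1-zP(u)=0$ has, over the Puiseux series in $z$ and counted with multiplicity, exactly $c$ small roots $u_1(z),\dots,u_c(z)$ (tending to $0$ as $z\to0$) and $d$ large roots $v_1(z),\dots,v_d(z)$ (tending to infinity as $z\to 0$), and no other roots. 4. $(W_{-d},\dots,W_c)$ is the unique solution of the following system of $c+d+1$ linear equations in $c+d+1$ unknowns, which has full rank: for $1\le i\le c$, $$\Bigl(zq\sum_{k=-d}^{-1}\{u^{>0}\}(P(u)u^k)W_k+z\{u^{>0}\}(P(u))W_0-\sum_{k=1}^{c}\{u^{>0}\}\bigl((1-zP(u))u^k\bigr)W_k\Bigr)\Big|_{u=u_i(z)}=0;$$ for $1\le j\le d$, $$\Bigl(zq\sum_{k=1}^{c}\{u^{<0}\}(P(u)u^k)W_k+z\{u^{<0}\}(P(u))W_0-\sum_{k=-d}^{-1}\{u^{<0}\}\bigl((1-zP(u))u^k\bigr)W_k\Bigr)\Big|_{u=v_j(z)}=0;$$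 and $$[u^0]\Bigl((1-zP(u))\sum_{k=-d}^{c}W_ku^k\Bigr)=1.$$ 5. Consequently $W$ and the $W_k$ have closed forms in terms of the roots: every $W_k$, $k\in\mathbb{Z}$, is a rational function with complex coefficients of $z$, $q$ and the roots $u_i(z),v_j(z)$, and $W$ is a rational function with complex coefficients of $z,u,q$ and these roots. -/

import Mathlib

open scoped LaurentPolynomial

noncomputable section

namespace LatticePath

/-! ### Walks and crossings of the x-axis

A (weighted) step set is a Laurent polynomial `P(u) = ∑ p_i u^i`: the allowed jumps are the
exponents `i` with `p_i ≠ 0`, and the jump `i` has weight `p_i`. -/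

/-- The walks with `n` steps, starting at altitude `0`; a walk is the sequence of its jumps. -/
def walks (P : ℂ[T;T⁻¹]) (n : ℕ) : Finset (Fin n → ℤ) :=
  Fintype.piFinset fun _ => P.coeff.support

/-- The altitude of the walk `s` after `t` steps. -/
def altitude {n : ℕ} (s : Fin n → ℤ) (t : ℕ) : ℤ :=
  ∑ i with i.val < t, s i

/-- The number of crossings of the x-axis: the number of steps that go from a positive to a
negative altitude, or from a negative to a positive altitude. -/
def crossings {n : ℕ} (s : Fin n → ℤ) : ℕ :=
  Finset.card {t ∈ Finset.range n | 0 < t ∧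
    ((0 < altitude s t ∧ altitude s (t + 1) < 0) ∨
      (altitude s t < 0 ∧ 0 < altitude s (t + 1)))}

/-- The weight of a walk: the product of the weights of its jumps. -/
def weight (P : ℂ[T;T⁻¹]) {n : ℕ} (s : Fin n → ℤ) : ℂ :=
  ∏ i, P.coeff (s i)

/-- The walks of length `n` that end at altitude `k` and have `j` crossings of the x-axis. -/
def crossingWalks (P : ℂ[T;T⁻¹]) (n : ℕ) (k : ℤ) (j : ℕ) : Finset (Fin n → ℤ) :=
  {s ∈ walks P n | altitude s n = k ∧ crossings s = j}

/-- The (weighted) number `w_{n,k,j}` of walks of length `n` that end at altitude `k` and have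
`j` crossings of the x-axis. -/
def walkCount (P : ℂ[T;T⁻¹]) (n : ℕ) (k : ℤ) (j : ℕ) : ℂ :=
  ∑ s ∈ crossingWalks P n k j, weight P s

/-- If all jumps have weight `1`, then `w_{n,k,j}` is the number of walks. -/
theorem walkCount_eq_card (P : ℂ[T;T⁻¹]) (hP : ∀ i ∈ P.coeff.support, P.coeff i = 1)
    (n : ℕ) (k : ℤ) (j : ℕ) : walkCount P n k j = (crossingWalks P n k j).card := by
  have h : ∀ s ∈ crossingWalks P n k j, weight P s = 1 := by
    intro s hs
    have hs' : ∀ i, s i ∈ P.coeff.support :=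
      Fintype.mem_piFinset.1 (Finset.mem_filter.1 hs).1
    exact Finset.prod_eq_one fun i _ => hP _ (hs' i)
  rw [walkCount, Finset.sum_congr rfl h]
  simp

/-! ### The generating functions -/

/-- The ring `ℂ[q][u, 1/u]`. -/
abbrev Coeffs : Type := (Polynomial ℂ)[T;T⁻¹]

/-- The generating function `W(z,u,q)`, in the ring `ℂ[q][u, 1/u][[z]]`. -/
def walkGF (P : ℂ[T;T⁻¹]) : PowerSeries Coeffs :=
  PowerSeries.mk fun n => ∑ s ∈ walks P n,
    LaurentPolynomial.C (Polynomial.monomial (crossings s) (weight P s)) *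
      LaurentPolynomial.T (altitude s n)

/-- The coefficient of `z^n u^k q^j` in `W(z,u,q)` is `w_{n,k,j}`. -/
theorem coeff_walkGF (P : ℂ[T;T⁻¹]) (n : ℕ) (k : ℤ) (j : ℕ) :
    ((PowerSeries.coeff n (walkGF P)).coeff k).coeff j = walkCount P n k j := by
  have h : ∀ s : Fin n → ℤ,
      ((LaurentPolynomial.C (Polynomial.monomial (crossings s) (weight P s)) *
        LaurentPolynomial.T (altitude s n) : Coeffs).coeff k).coeff j =
      if altitude s n = k ∧ crossings s = j then weight P s else 0 := by
    intro s
    rw [← LaurentPolynomial.single_eq_C_mul_T, AddMonoidAlgebra.coeff_single,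
      Finsupp.single_apply]
    by_cases h1 : altitude s n = k <;> simp [h1, Polynomial.coeff_monomial]
  simp only [walkGF, PowerSeries.coeff_mk, walkCount, crossingWalks, Finset.sum_filter, ← h]
  simp [AddMonoidAlgebra.coeff_sum, Finsupp.finsetSum_apply]

/-- The generating function `W_k(z,q) = [u^k] W(z,u,q)`, in `ℂ[q][[z]]`. -/
def altitudeGF (P : ℂ[T;T⁻¹]) (k : ℤ) : PowerSeries (Polynomial ℂ) :=
  PowerSeries.mk fun n => (PowerSeries.coeff n (walkGF P)).coeff k

/-- The variable `z` in `ℂ[q][u, 1/u][[z]]`. -/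
def zVar : PowerSeries Coeffs := PowerSeries.X

/-- The variable `u` in `ℂ[q][u, 1/u][[z]]`. -/
def uVar : PowerSeries Coeffs := PowerSeries.C (LaurentPolynomial.T 1)

/-- The variable `q` in `ℂ[q][u, 1/u][[z]]`. -/
def qVar : PowerSeries Coeffs := PowerSeries.C (LaurentPolynomial.C Polynomial.X)

/-- A Laurent polynomial in `u` with complex coefficients, as an element of
`ℂ[q][u, 1/u][[z]]`. -/
def ofLaurent (f : ℂ[T;T⁻¹]) : PowerSeries Coeffs :=
  PowerSeries.C (f.coeff.sum fun n a =>
    LaurentPolynomial.C (Polynomial.C a) * LaurentPolynomial.T n)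

/-- The inclusion of `ℂ[q][[z]]` in `ℂ[q][u, 1/u][[z]]`. -/
def inclAltitude : PowerSeries (Polynomial ℂ) →+* PowerSeries Coeffs :=
  PowerSeries.map LaurentPolynomial.C

/-! ### The step set and the operators `{u^{>0}}`, `{u^{<0}}` -/

/-- The largest amplitude `c` of a downward jump (`0` if there is none). -/
def maxDown (P : ℂ[T;T⁻¹]) : ℕ := P.coeff.support.sup fun i => (-i).toNat

/-- The largest amplitude `d` of an upward jump (`0` if there is none). -/
def maxUp (P : ℂ[T;T⁻¹]) : ℕ := P.coeff.support.sup fun i => i.toNat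

/-- The operator `{u^{>0}}`: the part of positive degree of a Laurent polynomial. -/
def posPart (f : ℂ[T;T⁻¹]) : ℂ[T;T⁻¹] :=
  AddMonoidAlgebra.ofCoeff (f.coeff.filter fun n => 0 < n)

/-- The operator `{u^{<0}}`: the part of negative degree of a Laurent polynomial. -/
def negPart (f : ℂ[T;T⁻¹]) : ℂ[T;T⁻¹] :=
  AddMonoidAlgebra.ofCoeff (f.coeff.filter fun n => n < 0)

/-- The value of the Laurent polynomial `f` at `u = x`. -/
def evalAt {L : Type*} [Field L] [Algebra ℂ L] (x : L) (f : ℂ[T;T⁻¹]) : L :=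
  f.coeff.sum fun n a => algebraMap ℂ L a * x ^ n

/-! ### The roots of the kernel

The roots of `1 - z P(u) = 0` are Puiseux series in `z` over `ℂ`. They are taken in the field
of Hahn series with complex coefficients and rational exponents, which contains the
algebraically closed field of Puiseux series, so that it has no further roots. -/

/-- The polynomial `u^c (1 - z P(u))` in `u`, where `c` is the largest amplitude of a downward
jump. -/
def kernel (P : ℂ[T;T⁻¹]) : Polynomial (HahnSeries ℚ ℂ) :=
  Polynomial.X ^ maxDown P - Polynomial.C (HahnSeries.single 1 1) *
    ∑ i ∈ P.coeff.support, Polynomial.C (HahnSeries.C (P.coeff i)) *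
      Polynomial.X ^ (i + (maxDown P : ℤ)).toNat

/-- `u_1, …, u_c` are the small roots (`u_i → 0` as `z → 0`) and `v_1, …, v_d` are the large
roots (`|v_j| → ∞` as `z → 0`) of `1 - z P(u) = 0`, each root being listed with its
multiplicity. -/
structure IsKernelRoots (P : ℂ[T;T⁻¹]) (u : Fin (maxDown P) → HahnSeries ℚ ℂ)
    (v : Fin (maxUp P) → HahnSeries ℚ ℂ) : Prop where
  small : ∀ i, 0 < (u i).orderTop
  large : ∀ j, (v j).orderTop < 0
  roots_eq : (kernel P).roots = Finset.univ.val.map u + Finset.univ.val.map v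

/-! ### A common field for the roots and for the generating functions -/

/-- The field `ℂ(u,q)`. -/
abbrev BaseField : Type := FractionRing Coeffs

/-- Hahn series in `z` with rational exponents and coefficients in `ℂ(u,q)`. -/
abbrev Ambient : Type := HahnSeries ℚ BaseField

/-- The inclusion of `ℂ[q][u, 1/u][[z]]` in the ambient field. -/
def embed : PowerSeries Coeffs →+* Ambient :=
  (HahnSeries.ofPowerSeries ℚ BaseField).comp (PowerSeries.map (algebraMap Coeffs BaseField))

/-- The inclusion of the series in `z` over `ℂ` in the ambient field. -/
def embedRoot (x : HahnSeries ℚ ℂ) : Ambient := x.map (algebraMap ℂ BaseField)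

/-- `W_k(z,q)` in the ambient field. -/
def altitudeSeries (P : ℂ[T;T⁻¹]) (k : ℤ) : Ambient := embed (inclAltitude (altitudeGF P k))

/-! ### The linear system for `W_{-d}, …, W_c` -/

/-- The coefficient of `W_k` in the equation given by a small root `x`:
`z q {u^{>0}}(P u^k)` if `k < 0`, `z {u^{>0}} P` if `k = 0`,
`-{u^{>0}}((1 - z P) u^k)` if `k > 0`, all at `u = x`. -/
def smallEntry (P : ℂ[T;T⁻¹]) (x : Ambient) (k : ℤ) : Ambient :=
  if k < 0 then embed zVar * embed qVar * evalAt x (posPart (P * LaurentPolynomial.T k))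
  else if k = 0 then embed zVar * evalAt x (posPart P)
  else -(evalAt x (posPart (LaurentPolynomial.T k)) -
    embed zVar * evalAt x (posPart (P * LaurentPolynomial.T k)))

/-- The coefficient of `W_k` in the equation given by a large root `x`:
`z q {u^{<0}}(P u^k)` if `k > 0`, `z {u^{<0}} P` if `k = 0`,
`-{u^{<0}}((1 - z P) u^k)` if `k < 0`, all at `u = x`. -/
def largeEntry (P : ℂ[T;T⁻¹]) (x : Ambient) (k : ℤ) : Ambient :=
  if 0 < k then embed zVar * embed qVar * evalAt x (negPart (P * LaurentPolynomial.T k))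
  else if k = 0 then embed zVar * evalAt x (negPart P)
  else -(evalAt x (negPart (LaurentPolynomial.T k)) -
    embed zVar * evalAt x (negPart (P * LaurentPolynomial.T k)))

/-- The coefficient `[u^0]((1 - z P) u^k)` of `W_k` in the equation given by `[u^0]`. -/
def constEntry (P : ℂ[T;T⁻¹]) (k : ℤ) : Ambient :=
  (if k = 0 then 1 else 0) - embed zVar * algebraMap ℂ Ambient (P.coeff (-k))

/-- The matrix of the system of `c + d + 1` linear equations in the `c + d + 1` unknowns
`W_{-d}, …, W_c`: one equation for each small root, one for each large root, and one for the
extraction of `[u^0]`. -/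
def systemMatrix (P : ℂ[T;T⁻¹]) (u : Fin (maxDown P) → HahnSeries ℚ ℂ)
    (v : Fin (maxUp P) → HahnSeries ℚ ℂ) :
    Matrix (Fin (maxDown P) ⊕ Fin (maxUp P) ⊕ Unit)
      (Finset.Icc (-(maxUp P : ℤ)) (maxDown P : ℤ)) Ambient :=
  Matrix.of fun r k =>
    match r with
    | Sum.inl i => smallEntry P (embedRoot (u i)) k
    | Sum.inr (Sum.inl j) => largeEntry P (embedRoot (v j)) k
    | Sum.inr (Sum.inr _) => constEntry P k

/-- The right-hand side of the linear system: `0` for each root, `1` for `[u^0]`. -/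
def systemRhs (P : ℂ[T;T⁻¹]) : Fin (maxDown P) ⊕ Fin (maxUp P) ⊕ Unit → Ambient
  | Sum.inl _ => 0
  | Sum.inr (Sum.inl _) => 0
  | Sum.inr (Sum.inr _) => 1

/-- The set of all roots of the kernel, in the ambient field. -/
def rootSet (P : ℂ[T;T⁻¹]) (u : Fin (maxDown P) → HahnSeries ℚ ℂ)
    (v : Fin (maxUp P) → HahnSeries ℚ ℂ) : Set Ambient :=
  Set.range (fun i => embedRoot (u i)) ∪ Set.range (fun j => embedRoot (v j))

end LatticePath

end

noncomputable section

namespace LatticePath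

/-! Cutting a walk at its last jump expresses `W_k` as `[k = 0]` plus `z` times a combination of the
`W_{k-i}`, where the jump `i` carries its weight and a factor `q` if it crosses the axis
(`altitudeGF_eq`). Writing that `q` as `1 - (1 - q)` gives the functional equation. Because of the
factor `z`, the recurrence is contracting: among families of series indexed by ℤ with orders bounded
below, it has at most one solution (`IsBoundedFamily.eq_of_contracting`).

The finite system is tied to this recurrence as follows. Extend a vector `x` on `[-d, c]` by zero
and let `e_m` be its residual in the recurrence. The small-root equations say that the part of `∑
e_m u^m` with `m > 0` vanishes at each `u_i`, the large-root equations say that the part with `m <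
0` vanishes at each `v_j`, and the last equation prescribes `e_0`. When the positive part is divided
by `1 - zP`, the factors of the small roots cancel, and those of the large roots expand in powers of
`u` with coefficients of bounded order. The quotient lives at altitudes above `c`, from which no
jump crosses the axis, so adding it repairs the recurrence at all `m > 0`; the mirror image repairs
`m < 0`. Thus `x` extends to a bounded solution on ℤ (`exists_bounded_extension`). For a zero
right-hand side, uniqueness forces `x = 0`, so the square matrix is invertible; for the actual
right-hand side, the extension of its solution must be the family of the `W_k`.

The small roots come from Hensel's lemma after the substitution `z = T^c`, `u = T/s`
(`exists_small_roots`), the large ones from the same argument for `P(1/u)`; being `c + d` distinct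
roots, they exhaust the degree of the kernel. Rationality follows by solving the system inside the
field generated by `z`, `q` and the roots, running the recurrence outwards, and dividing the
functional equation by `1 - zP`. The roots are algebraic over `ℂ(z)`, hence `W` is algebraic. -/

/-- The factor `q` of a jump from altitude `a` to altitude `b` that crosses the axis. -/
def crossingFactor {R : Type*} [One R] (q : R) (a b : ℤ) : R :=
  if (0 < a ∧ b < 0) ∨ (a < 0 ∧ 0 < b) then q else 1

/-! ### Recurrence obtained by cutting a walk at its last jump -/

theorem altitude_snoc_of_le {n : ℕ} (s : Fin n → ℤ) (i : ℤ) {t : ℕ} (ht : t ≤ n) :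
    altitude (Fin.snoc s i : Fin (n + 1) → ℤ) t = altitude s t := by
  simp only [altitude, Finset.sum_filter]
  rw [Fin.sum_univ_castSucc]
  simp [Nat.not_lt.2 ht]

theorem altitude_snoc_last {n : ℕ} (s : Fin n → ℤ) (i : ℤ) :
    altitude (Fin.snoc s i : Fin (n + 1) → ℤ) (n + 1) = altitude s n + i := by
  simp only [altitude, Finset.sum_filter]
  rw [Fin.sum_univ_castSucc]
  simp

theorem altitude_zero {n : ℕ} (s : Fin n → ℤ) : altitude s 0 = 0 := by
  simp [altitude]

theorem weight_snoc (P : ℂ[T;T⁻¹]) {n : ℕ} (s : Fin n → ℤ) (i : ℤ) :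
    weight P (Fin.snoc s i : Fin (n + 1) → ℤ) = weight P s * P.coeff i := by
  simp [weight, Fin.prod_univ_castSucc]

theorem crossings_snoc {n : ℕ} (s : Fin n → ℤ) (i : ℤ) :
    crossings (Fin.snoc s i : Fin (n + 1) → ℤ) = crossings s +
      if (0 < altitude s n ∧ altitude s n + i < 0) ∨ (altitude s n < 0 ∧ 0 < altitude s n + i)
      then 1 else 0 := by
  simp only [crossings, Finset.card_filter, Finset.sum_range_succ, altitude_snoc_last,
    altitude_snoc_of_le s i le_rfl]
  congr 1
  · refine Finset.sum_congr rfl fun t ht => ?_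
    have := Finset.mem_range.1 ht
    rw [altitude_snoc_of_le s i this.le, altitude_snoc_of_le s i this]
  -- The condition `0 < t` in `crossings` excludes nothing: at `t = 0` the altitude is `0`, so no
  -- crossing can start there.
  · rcases Nat.eq_zero_or_pos n with rfl | h
    · simp [altitude_zero]
    · simp [h]

theorem sum_walks_succ {M : Type*} [AddCommMonoid M] (P : ℂ[T;T⁻¹]) (n : ℕ)
    (f : (Fin (n + 1) → ℤ) → M) :
    ∑ s ∈ walks P (n + 1), f s =
      ∑ i ∈ P.coeff.support, ∑ s ∈ walks P n, f (Fin.snoc s i : Fin (n + 1) → ℤ) := by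
  rw [← Finset.sum_product']
  refine Finset.sum_bij' (fun s _ => (s (Fin.last n), Fin.init s))
    (fun x _ => (Fin.snoc x.2 x.1 : Fin (n + 1) → ℤ)) ?_ ?_ ?_ ?_ ?_
  · intro s hs
    have hs := Fintype.mem_piFinset.1 hs
    exact Finset.mem_product.2 ⟨hs _, Fintype.mem_piFinset.2 fun j => hs j.castSucc⟩
  · rintro ⟨i, s⟩ h
    obtain ⟨hi, hs⟩ := Finset.mem_product.1 h
    refine Fintype.mem_piFinset.2 fun j => ?_
    induction j using Fin.lastCases with
    | last => simpa using hi
    | cast j => simpa using Fintype.mem_piFinset.1 hs j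
  · intro s _
    simp
  · rintro ⟨i, s⟩ _
    simp
  · intro s _
    simp

/-- The coefficient of `z^n u^k` in `W`, a polynomial in `q`. -/
def walkPoly (P : ℂ[T;T⁻¹]) (n : ℕ) (k : ℤ) : Polynomial ℂ :=
  ∑ s ∈ walks P n, if altitude s n = k then Polynomial.monomial (crossings s) (weight P s) else 0

theorem coeff_coeff_walkGF (P : ℂ[T;T⁻¹]) (n : ℕ) (k : ℤ) :
    (PowerSeries.coeff n (walkGF P)).coeff k = walkPoly P n k := by
  rw [walkGF, PowerSeries.coeff_mk, AddMonoidAlgebra.coeff_sum, Finsupp.finsetSum_apply, walkPoly]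
  refine Finset.sum_congr rfl fun s _ => ?_
  rw [← LaurentPolynomial.single_eq_C_mul_T, AddMonoidAlgebra.coeff_single, Finsupp.single_apply]

theorem coeff_altitudeGF (P : ℂ[T;T⁻¹]) (n : ℕ) (k : ℤ) :
    PowerSeries.coeff n (altitudeGF P k) = walkPoly P n k := by
  rw [altitudeGF, PowerSeries.coeff_mk, coeff_coeff_walkGF]

theorem walkPoly_zero (P : ℂ[T;T⁻¹]) (k : ℤ) : walkPoly P 0 k = if k = 0 then 1 else 0 := by
  simp [walkPoly, walks, altitude_zero, crossings, weight, eq_comm]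

theorem walkPoly_succ (P : ℂ[T;T⁻¹]) (n : ℕ) (k : ℤ) :
    walkPoly P (n + 1) k = ∑ i ∈ P.coeff.support,
      Polynomial.C (P.coeff i) * crossingFactor Polynomial.X (k - i) k * walkPoly P n (k - i) := by
  rw [walkPoly, sum_walks_succ]
  refine Finset.sum_congr rfl fun i _ => ?_
  rw [walkPoly, Finset.mul_sum]
  refine Finset.sum_congr rfl fun s _ => ?_
  rw [altitude_snoc_last, weight_snoc, crossings_snoc]
  by_cases h : altitude s n = k - i
  · have h' : altitude s n + i = k := by omega
    rw [if_pos h', if_pos h, h', h, crossingFactor]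
    split_ifs
    · rw [← Polynomial.C_mul_X_pow_eq_monomial, ← Polynomial.C_mul_X_pow_eq_monomial, map_mul]
      ring
    · rw [← Polynomial.C_mul_X_pow_eq_monomial, ← Polynomial.C_mul_X_pow_eq_monomial, map_mul]
      ring
  · have h' : altitude s n + i ≠ k := by omega
    rw [if_neg h', if_neg h, mul_zero]

/-- This system is all that the linear algebra below needs to know about walks: it has a unique
solution with orders bounded below. -/
theorem altitudeGF_eq (P : ℂ[T;T⁻¹]) (k : ℤ) :
    altitudeGF P k = (if k = 0 then 1 else 0) + PowerSeries.X * ∑ i ∈ P.coeff.support,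
      PowerSeries.C (Polynomial.C (P.coeff i)) *
        crossingFactor (PowerSeries.C Polynomial.X) (k - i) k * altitudeGF P (k - i) := by
  ext1 n
  rw [map_add, coeff_altitudeGF]
  cases n with
  | zero => rw [walkPoly_zero]; split_ifs <;> simp
  | succ n =>
    rw [PowerSeries.coeff_succ_X_mul, walkPoly_succ, map_sum]
    have : PowerSeries.coeff (n + 1) (if k = 0 then 1 else 0 : PowerSeries (Polynomial ℂ)) = 0 := by
      split_ifs <;> simp [PowerSeries.coeff_one]
    rw [this, zero_add]
    refine Finset.sum_congr rfl fun i _ => ?_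
    have hc : (crossingFactor (PowerSeries.C Polynomial.X) (k - i) k :
        PowerSeries (Polynomial ℂ)) = PowerSeries.C (crossingFactor Polynomial.X (k - i) k) := by
      unfold crossingFactor; split_ifs <;> simp
    rw [hc, ← map_mul, PowerSeries.coeff_C_mul, coeff_altitudeGF]

/-! ### The functional equation -/

theorem le_maxUp {P : ℂ[T;T⁻¹]} {i : ℤ} (h : P.coeff i ≠ 0) : i ≤ maxUp P := by
  have : i.toNat ≤ maxUp P :=
    Finset.le_sup (f := fun i : ℤ => i.toNat) (Finsupp.mem_support_iff.2 h)
  omega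

theorem neg_maxDown_le {P : ℂ[T;T⁻¹]} {i : ℤ} (h : P.coeff i ≠ 0) : -(maxDown P : ℤ) ≤ i := by
  have : (-i).toNat ≤ maxDown P :=
    Finset.le_sup (f := fun i : ℤ => (-i).toNat) (Finsupp.mem_support_iff.2 h)
  omega

theorem coeff_posPart (f : ℂ[T;T⁻¹]) (n : ℤ) :
    (posPart f).coeff n = if 0 < n then f.coeff n else 0 := by
  simp [posPart, Finsupp.filter_apply]

theorem coeff_negPart (f : ℂ[T;T⁻¹]) (n : ℤ) :
    (negPart f).coeff n = if n < 0 then f.coeff n else 0 := by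
  simp [negPart, Finsupp.filter_apply]

theorem coeff_mul_T {R : Type*} [Semiring R] (f : R[T;T⁻¹]) (k n : ℤ) :
    (f * LaurentPolynomial.T k).coeff n = f.coeff (n - k) := by
  rw [LaurentPolynomial.T, AddMonoidAlgebra.coeff_mul_single_apply, mul_one, sub_eq_add_neg]

/-- Passes from summing over the starting altitude `j` of a jump that ends at `k` to summing over
the jump `i = k - j`. -/
theorem sum_coeff_sub {R : Type*} [Semiring R] (P : ℂ[T;T⁻¹]) (φ : ℂ →+* R) (g : ℤ → R)
    (S : Finset ℤ) (k : ℤ) :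
    ∑ j ∈ S, φ (P.coeff (k - j)) * g j =
      ∑ i ∈ P.coeff.support, if k - i ∈ S then φ (P.coeff i) * g (k - i) else 0 := by
  rw [← Finset.sum_filter, ← Finset.sum_filter_of_ne (p := fun j => P.coeff (k - j) ≠ 0)]
  · refine Finset.sum_nbij' (fun j => k - j) (fun i => k - i) ?_ ?_ ?_ ?_ ?_ <;>
      simp +contextual
  · intro j _ h h0
    simp [h0] at h

theorem coeff_ofLaurent_mul (f : ℂ[T;T⁻¹]) (G : PowerSeries Coeffs) (n : ℕ) (k : ℤ) :
    (PowerSeries.coeff n (ofLaurent f * G)).coeff k =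
      ∑ i ∈ f.coeff.support, Polynomial.C (f.coeff i) * (PowerSeries.coeff n G).coeff (k - i) := by
  rw [ofLaurent, PowerSeries.coeff_C_mul, Finsupp.sum, Finset.sum_mul,
    AddMonoidAlgebra.coeff_sum, Finsupp.finsetSum_apply]
  refine Finset.sum_congr rfl fun i _ => ?_
  rw [mul_assoc, LaurentPolynomial.T_mul, ← LaurentPolynomial.smul_eq_C_mul,
    AddMonoidAlgebra.coeff_smul, Finsupp.smul_apply, coeff_mul_T, smul_eq_mul]

theorem coeff_ofLaurent_mul_inclAltitude (f : ℂ[T;T⁻¹]) (A : PowerSeries (Polynomial ℂ)) (n : ℕ)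
    (k : ℤ) : (PowerSeries.coeff n (ofLaurent f * inclAltitude A)).coeff k =
      Polynomial.C (f.coeff k) * PowerSeries.coeff n A := by
  rw [coeff_ofLaurent_mul]
  have h (i : ℤ) : (PowerSeries.coeff n (inclAltitude A)).coeff (k - i) =
      if i = k then PowerSeries.coeff n A else 0 := by
    rw [inclAltitude, PowerSeries.coeff_map, ← mul_one (LaurentPolynomial.C _),
      ← LaurentPolynomial.T_zero, ← LaurentPolynomial.single_eq_C_mul_T,
      AddMonoidAlgebra.coeff_single, Finsupp.single_apply]
    simp [sub_eq_zero, eq_comm]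
  simp +contextual [h]

/-- All jumps are first counted with factor `1`; a crossing jump is then corrected by `-(1 - X)`. A
crossing that ends at `k > 0` starts at some `j` with `-d < j < 0`, since the jump is at most `d`
and `k ≥ 1`; symmetrically for `k < 0`. This explains the open intervals. -/
theorem walkPoly_succ_eq_sub (P : ℂ[T;T⁻¹]) (n : ℕ) (k : ℤ) :
    walkPoly P (n + 1) k =
      ∑ i ∈ P.coeff.support, Polynomial.C (P.coeff i) * walkPoly P n (k - i) -
      (1 - Polynomial.X) *
        (∑ j ∈ Finset.Ioo (-(maxUp P : ℤ)) 0, (if 0 < k then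
            Polynomial.C (P.coeff (k - j)) * walkPoly P n j else 0) +
          ∑ j ∈ Finset.Ioo 0 (maxDown P : ℤ), if k < 0 then
            Polynomial.C (P.coeff (k - j)) * walkPoly P n j else 0) := by
  have h1 : ∀ S : Finset ℤ, ∑ j ∈ S, Polynomial.C (P.coeff (k - j)) * walkPoly P n j = _ :=
    fun S => sum_coeff_sub P Polynomial.C (walkPoly P n) S k
  rw [walkPoly_succ]
  rcases lt_trichotomy k 0 with hk | rfl | hk
  · simp only [hk, hk.not_gt, if_true, if_false, Finset.sum_const_zero, zero_add, h1]
    rw [Finset.mul_sum, ← Finset.sum_sub_distrib]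
    refine Finset.sum_congr rfl fun i hi => ?_
    have := neg_maxDown_le (Finsupp.mem_support_iff.1 hi)
    by_cases h : 0 < k - i
    · rw [if_pos (Finset.mem_Ioo.2 ⟨h, by omega⟩), crossingFactor, if_pos (Or.inl ⟨h, hk⟩)]
      ring
    · rw [if_neg (fun h' => h (Finset.mem_Ioo.1 h').1), crossingFactor, if_neg (by omega)]
      ring
  · simp [crossingFactor]
  · simp only [hk, hk.not_gt, if_true, if_false, Finset.sum_const_zero, add_zero, h1]
    rw [Finset.mul_sum, ← Finset.sum_sub_distrib]
    refine Finset.sum_congr rfl fun i hi => ?_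
    have := le_maxUp (Finsupp.mem_support_iff.1 hi)
    by_cases h : k - i < 0
    · rw [if_pos (Finset.mem_Ioo.2 ⟨by omega, h⟩), crossingFactor, if_pos (Or.inr ⟨h, hk⟩)]
      ring
    · rw [if_neg (fun h' => h (Finset.mem_Ioo.1 h').2), crossingFactor, if_neg (by omega)]
      ring

theorem functional_equation (P : ℂ[T;T⁻¹]) :
    (1 - zVar * ofLaurent P) * walkGF P =
      1 - zVar * (1 - qVar) *
        (∑ k ∈ Finset.Ioo (-(maxUp P : ℤ)) 0,
            ofLaurent (posPart (P * LaurentPolynomial.T k)) * inclAltitude (altitudeGF P k) +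
          ∑ k ∈ Finset.Ioo 0 (maxDown P : ℤ),
            ofLaurent (negPart (P * LaurentPolynomial.T k)) * inclAltitude (altitudeGF P k)) := by
  have hq : (1 : PowerSeries Coeffs) - qVar =
      PowerSeries.C (LaurentPolynomial.C (1 - Polynomial.X)) := by simp [qVar]
  rw [sub_mul, one_mul, sub_eq_iff_eq_add, mul_assoc, mul_assoc, hq, zVar]
  ext1 n
  refine LaurentPolynomial.ext fun k => ?_
  rw [coeff_coeff_walkGF, map_add, map_sub]
  cases n with
  | zero =>
    rw [PowerSeries.coeff_zero_X_mul, PowerSeries.coeff_zero_X_mul, sub_zero, add_zero,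
      walkPoly_zero, PowerSeries.coeff_zero_one, AddMonoidAlgebra.one_def,
      AddMonoidAlgebra.coeff_single, Finsupp.single_apply]
    simp only [eq_comm]
  | succ n =>
    rw [PowerSeries.coeff_succ_X_mul, PowerSeries.coeff_succ_X_mul, PowerSeries.coeff_C_mul,
      AddMonoidAlgebra.coeff_add, AddMonoidAlgebra.coeff_sub, Finsupp.add_apply,
      Finsupp.sub_apply, coeff_ofLaurent_mul, ← LaurentPolynomial.smul_eq_C_mul,
      AddMonoidAlgebra.coeff_smul, Finsupp.smul_apply, map_add, map_sum, map_sum,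
      AddMonoidAlgebra.coeff_add, AddMonoidAlgebra.coeff_sum, AddMonoidAlgebra.coeff_sum,
      Finsupp.add_apply, Finsupp.finsetSum_apply, Finsupp.finsetSum_apply]
    simp only [coeff_ofLaurent_mul_inclAltitude, coeff_posPart, coeff_negPart, coeff_mul_T,
      coeff_altitudeGF, coeff_coeff_walkGF]
    rw [walkPoly_succ_eq_sub, PowerSeries.coeff_one]
    simp only [Nat.succ_ne_zero, if_false, AddMonoidAlgebra.coeff_zero, Finsupp.zero_apply,
      smul_eq_mul, apply_ite Polynomial.C, ite_mul, map_zero, zero_mul]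
    ring

/-! ### Families of Hahn series with orders bounded below -/

section Bounded

variable {K : Type*} [Field K]

/-- The orders of the members of the family are bounded below. -/
def IsBoundedFamily {ι : Type*} (y : ι → HahnSeries ℚ K) : Prop :=
  ∃ b : ℚ, ∀ k, (b : WithTop ℚ) ≤ (y k).orderTop

theorem le_orderTop_sum {ι : Type*} (s : Finset ι) (f : ι → HahnSeries ℚ K) (b : WithTop ℚ)
    (h : ∀ i ∈ s, b ≤ (f i).orderTop) : b ≤ (∑ i ∈ s, f i).orderTop := by
  classical
  induction s using Finset.induction_on with
  | empty => simp
  | insert a s ha ih =>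
    rw [Finset.sum_insert ha]
    exact (le_min (h a (Finset.mem_insert_self a s))
      (ih fun i hi => h i (Finset.mem_insert_of_mem hi))).trans
      HahnSeries.min_orderTop_le_orderTop_add

theorem IsBoundedFamily.add {ι : Type*} {f g : ι → HahnSeries ℚ K} (hf : IsBoundedFamily f)
    (hg : IsBoundedFamily g) : IsBoundedFamily fun i => f i + g i := by
  obtain ⟨a, ha⟩ := hf
  obtain ⟨b, hb⟩ := hg
  refine ⟨min a b, fun i => le_trans (le_min ?_ ?_) HahnSeries.min_orderTop_le_orderTop_add⟩
  · exact (WithTop.coe_le_coe.2 (min_le_left a b)).trans (ha i)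
  · exact (WithTop.coe_le_coe.2 (min_le_right a b)).trans (hb i)

theorem IsBoundedFamily.neg {ι : Type*} {f : ι → HahnSeries ℚ K} (hf : IsBoundedFamily f) :
    IsBoundedFamily fun i => -f i := by
  simpa only [IsBoundedFamily, HahnSeries.orderTop_neg] using hf

theorem isBoundedFamily_of_finite {ι : Type*} (f : ι → HahnSeries ℚ K) (s : Finset ι)
    (hs : ∀ i ∉ s, f i = 0) : IsBoundedFamily f := by
  classical
  induction s using Finset.induction_on generalizing f with
  | empty => exact ⟨0, fun i => by simp [hs i (Finset.notMem_empty i)]⟩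
  | insert a s _ ih =>
    obtain ⟨b, hb⟩ := ih (fun i => if i = a then 0 else f i) fun i hi => by
      by_cases h : i = a
      · simp [h]
      · simp [h, hs i (by simp [h, hi])]
    by_cases h0 : f a = 0
    · refine ⟨b, fun i => ?_⟩
      by_cases h : i = a
      · simp [h, h0]
      · simpa [h] using hb i
    · refine ⟨min b (f a).order, fun i => ?_⟩
      by_cases h : i = a
      · rw [h, ← HahnSeries.order_eq_orderTop_of_ne_zero h0]
        exact WithTop.coe_le_coe.2 (min_le_right _ _)
      · exact (WithTop.coe_le_coe.2 (min_le_left _ _)).trans (by simpa [h] using hb i)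

theorem IsBoundedFamily.comp {ι κ : Type*} {f : ι → HahnSeries ℚ K} (hf : IsBoundedFamily f)
    (g : κ → ι) : IsBoundedFamily fun i => f (g i) :=
  hf.imp fun _ hb i => hb (g i)

theorem IsBoundedFamily.ite_zero {ι : Type*} {f : ι → HahnSeries ℚ K} (hf : IsBoundedFamily f)
    (p : ι → Prop) [DecidablePred p] : IsBoundedFamily fun i => if p i then f i else 0 :=
  hf.imp fun b hb i => by beta_reduce; split_ifs <;> simp [hb i]

/-- A bounded family that solves a contracting homogeneous system vanishes. -/
theorem IsBoundedFamily.eq_zero {ι κ : Type*} {y : ι → HahnSeries ℚ K} (hy : IsBoundedFamily y)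
    {z : HahnSeries ℚ K} (hz : 1 ≤ z.orderTop) (s : Finset κ) (a : ι → κ → HahnSeries ℚ K)
    (ha : ∀ i j, 0 ≤ (a i j).orderTop) (σ : ι → κ → ι)
    (h : ∀ i, y i = z * ∑ j ∈ s, a i j * y (σ i j)) (i : ι) : y i = 0 := by
  obtain ⟨b, hb⟩ := hy
  -- Each substitution of the system into itself raises the common lower bound of the orders by at
  -- least `1`, the order of `z`. Only zero has order above every such bound.
  have key : ∀ n : ℕ, ∀ i, ((b + n : ℚ) : WithTop ℚ) ≤ (y i).orderTop := by
    intro n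
    induction n with
    | zero => simpa using hb
    | succ n ih =>
      intro i
      rw [h i, HahnSeries.orderTop_mul]
      have h1 : ((b + n : ℚ) : WithTop ℚ) ≤ (∑ j ∈ s, a i j * y (σ i j)).orderTop := by
        refine le_orderTop_sum _ _ _ fun j _ => ?_
        rw [HahnSeries.orderTop_mul]
        exact (ih (σ i j)).trans (le_add_of_nonneg_left (ha i j))
      calc ((b + (n + 1 : ℕ) : ℚ) : WithTop ℚ) = 1 + ((b + n : ℚ) : WithTop ℚ) := by
            rw [← WithTop.coe_one, ← WithTop.coe_add]; push_cast; rw [← add_assoc, add_comm]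
        _ ≤ _ := add_le_add hz h1
  by_contra h0
  obtain ⟨n, hn⟩ := exists_nat_gt ((y i).order - b)
  have := key n i
  rw [← HahnSeries.order_eq_orderTop_of_ne_zero h0, WithTop.coe_le_coe] at this
  linarith

/-- A contracting linear system has at most one bounded solution. -/
theorem IsBoundedFamily.eq_of_contracting {ι κ : Type*} {y y' : ι → HahnSeries ℚ K}
    (hy : IsBoundedFamily y) (hy' : IsBoundedFamily y') {z : HahnSeries ℚ K}
    (hz : 1 ≤ z.orderTop) (s : Finset κ) (a : ι → κ → HahnSeries ℚ K)
    (ha : ∀ i j, 0 ≤ (a i j).orderTop) (σ : ι → κ → ι) (b : ι → HahnSeries ℚ K)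
    (h : ∀ i, y i = b i + z * ∑ j ∈ s, a i j * y (σ i j))
    (h' : ∀ i, y' i = b i + z * ∑ j ∈ s, a i j * y' (σ i j)) (i : ι) : y i = y' i := by
  have := IsBoundedFamily.eq_zero (hy.add hy'.neg) hz s a ha σ (fun i => by
    simp only [mul_add, mul_neg, Finset.sum_add_distrib, Finset.sum_neg_distrib]
    linear_combination h i - h' i) i
  exact eq_of_sub_eq_zero ((sub_eq_add_neg _ _).trans this)

theorem orderTop_inv_nonneg {x : HahnSeries ℚ K} (hx : x.orderTop < 0) : 0 ≤ (x⁻¹).orderTop := by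
  have h0 : x ≠ 0 := by rintro rfl; simp at hx
  have h1 := HahnSeries.orderTop_mul x x⁻¹
  rw [mul_inv_cancel₀ h0, HahnSeries.orderTop_one] at h1
  by_contra h
  exact ((add_le_add_right (not_le.1 h).le _).trans_lt (by simpa using hx)).ne h1.symm

theorem isBoundedFamily_coeff_mul {f g : PowerSeries (HahnSeries ℚ K)}
    (hf : IsBoundedFamily fun n => PowerSeries.coeff n f)
    (hg : IsBoundedFamily fun n => PowerSeries.coeff n g) :
    IsBoundedFamily fun n => PowerSeries.coeff n (f * g) := by
  obtain ⟨a, ha⟩ := hf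
  obtain ⟨b, hb⟩ := hg
  refine ⟨a + b, fun n => ?_⟩
  beta_reduce
  rw [PowerSeries.coeff_mul]
  refine le_orderTop_sum _ _ _ fun i _ => ?_
  rw [HahnSeries.orderTop_mul, WithTop.coe_add]
  exact add_le_add (ha _) (hb _)

theorem isBoundedFamily_coeff_coe (f : Polynomial (HahnSeries ℚ K)) :
    IsBoundedFamily fun n => PowerSeries.coeff n (f : PowerSeries (HahnSeries ℚ K)) :=
  isBoundedFamily_of_finite _ f.support fun n hn => by
    simpa [Polynomial.coeff_coe] using hn

/-- The geometric series `1/(X - v) = -∑ v^{-n-1} X^n`. Its coefficients have orders bounded below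
because `v⁻¹` has nonnegative order, which is why the factors of large roots can be inverted. -/
theorem exists_bounded_inv_X_sub_C {v : HahnSeries ℚ K} (h0 : v ≠ 0) (hv : 0 ≤ (v⁻¹).orderTop) :
    ∃ g : PowerSeries (HahnSeries ℚ K), IsBoundedFamily (fun n => PowerSeries.coeff n g) ∧
      (PowerSeries.X - PowerSeries.C v) * g = 1 := by
  refine ⟨PowerSeries.mk fun n => -(v⁻¹) ^ (n + 1), ⟨0, fun n => ?_⟩, ?_⟩
  · beta_reduce
    rw [PowerSeries.coeff_mk, HahnSeries.orderTop_neg]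
    exact (nsmul_nonneg hv (n + 1)).trans HahnSeries.orderTop_nsmul_le_orderTop_pow
  · ext1 n
    rw [sub_mul, map_sub, PowerSeries.coeff_C_mul, PowerSeries.coeff_mk, PowerSeries.coeff_one]
    cases n with
    | zero => simp [h0]
    | succ n =>
      rw [PowerSeries.coeff_succ_X_mul, PowerSeries.coeff_mk, if_neg n.succ_ne_zero]
      rw [pow_succ' _ (n + 1)]
      linear_combination (v⁻¹) ^ (n + 1) * mul_inv_cancel₀ h0

theorem exists_bounded_inv_prod {ι : Type*} (s : Finset ι) {v : ι → HahnSeries ℚ K}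
    (h0 : ∀ i, v i ≠ 0) (hv : ∀ i, 0 ≤ ((v i)⁻¹).orderTop) :
    ∃ g : PowerSeries (HahnSeries ℚ K), IsBoundedFamily (fun n => PowerSeries.coeff n g) ∧
      (∏ i ∈ s, (PowerSeries.X - PowerSeries.C (v i))) * g = 1 := by
  classical
  induction s using Finset.induction_on with
  | empty => exact ⟨1, by simpa using isBoundedFamily_coeff_coe (K := K) 1, by simp⟩
  | insert a s ha ih =>
    obtain ⟨g, hg, h⟩ := ih
    obtain ⟨g', hg', h'⟩ := exists_bounded_inv_X_sub_C (h0 a) (hv a)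
    refine ⟨g' * g, isBoundedFamily_coeff_mul hg' hg, ?_⟩
    rw [Finset.prod_insert ha, mul_mul_mul_comm, h, h', one_mul]

end Bounded

/-! ### The kernel polynomial over a field -/

section KernelPoly

variable {F : Type*} [Field F]

/-- The polynomial `u^c (1 - z ∑ p_i u^i)`. -/
def kernelPoly (z : F) (p : ℤ → F) (I : Finset ℤ) (c : ℕ) : Polynomial F :=
  Polynomial.X ^ c - Polynomial.C z *
    ∑ i ∈ I, Polynomial.C (p i) * Polynomial.X ^ (i + (c : ℤ)).toNat

variable {z : F} {p : ℤ → F} {I : Finset ℤ} {c d : ℕ}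

theorem natDegree_kernelPoly_le (hI : ∀ i ∈ I, i ≤ d) : (kernelPoly z p I c).natDegree ≤ c + d := by
  refine (Polynomial.natDegree_sub_le _ _).trans (max_le ?_ ?_)
  · simp
  · refine (Polynomial.natDegree_C_mul_le _ _).trans
      (Polynomial.natDegree_sum_le_of_forall_le _ _ fun i hi => ?_)
    refine (Polynomial.natDegree_C_mul_X_pow_le _ _).trans ?_
    have := hI i hi
    omega

/-- The coefficient of `X^c` is `1 - z p_0`. -/
theorem kernelPoly_ne_zero (hI : ∀ i ∈ I, -(c : ℤ) ≤ i) (hp : ∀ i ∉ I, p i = 0)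
    (h : 1 - z * p 0 ≠ 0) : kernelPoly z p I c ≠ 0 := by
  intro h0
  apply h
  have h1 := congrArg (fun f : Polynomial F => Polynomial.coeff f c) h0
  simp only [kernelPoly, Polynomial.coeff_sub, Polynomial.coeff_X_pow, if_true,
    Polynomial.coeff_C_mul, Polynomial.finsetSum_coeff, Polynomial.coeff_zero] at h1
  rw [Finset.sum_eq_single (0 : ℤ)] at h1
  · simpa using h1
  · intro i hi hi0
    have := hI i hi
    rw [if_neg (by omega), mul_zero]
  · intro h; simp [hp 0 h]

theorem eval_kernelPoly (hI : ∀ i ∈ I, -(c : ℤ) ≤ i) {x : F} (hx : x ≠ 0) :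
    (kernelPoly z p I c).eval x = x ^ c * (1 - z * ∑ i ∈ I, p i * x ^ i) := by
  simp only [kernelPoly, Polynomial.eval_sub, Polynomial.eval_pow, Polynomial.eval_X,
    Polynomial.eval_mul, Polynomial.eval_C, Polynomial.eval_finsetSum]
  rw [mul_sub, mul_one, mul_left_comm, Finset.mul_sum (f := fun i => p i * x ^ i)]
  congr 2
  refine Finset.sum_congr (M := F) rfl fun i hi => ?_
  have := hI i hi
  rw [← zpow_natCast x (i + c).toNat, Int.toNat_of_nonneg (by omega), zpow_add₀ hx, zpow_natCast]
  ring

theorem eval_kernelPoly_eq_zero_iff (hI : ∀ i ∈ I, -(c : ℤ) ≤ i) {x : F} (hx : x ≠ 0) :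
    (kernelPoly z p I c).eval x = 0 ↔ z * ∑ i ∈ I, p i * x ^ i = 1 := by
  rw [eval_kernelPoly hI hx, mul_eq_zero, sub_eq_zero]
  simp [hx, eq_comm]

/-- A polynomial of degree at most `card S`, with all members of `S` as roots. -/
theorem exists_eq_C_mul_prod {f : Polynomial F} (hf : f ≠ 0) (S : Finset F)
    (hS : ∀ x ∈ S, f.eval x = 0) (hd : f.natDegree ≤ S.card) :
    f.roots = S.val ∧ ∃ l ≠ 0, f = Polynomial.C l * ∏ x ∈ S, (Polynomial.X - Polynomial.C x) := by
  have hle : S.val ≤ f.roots := (Multiset.le_iff_subset S.nodup).2 fun x hx =>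
    (Polynomial.mem_roots hf).2 (hS x hx)
  have hr : f.roots = S.val := (Multiset.eq_of_le_of_card_le hle
    ((Polynomial.card_roots' f).trans hd)).symm
  refine ⟨hr, f.leadingCoeff, Polynomial.leadingCoeff_ne_zero.2 hf, ?_⟩
  have h := Polynomial.C_leadingCoeff_mul_prod_multiset_X_sub_C (p := f)
    (le_antisymm (Polynomial.card_roots' f) (by rw [hr]; exact hd))
  rw [hr] at h
  exact h.symm

/-- The degree is at most `c + d`, so `c + d` distinct roots are all the roots, each simple. -/
theorem exists_kernelPoly_eq_prod (hIc : ∀ i ∈ I, -(c : ℤ) ≤ i) (hId : ∀ i ∈ I, i ≤ d)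
    (hp : ∀ i ∉ I, p i = 0) (h : 1 - z * p 0 ≠ 0) (r : Fin c ⊕ Fin d → F)
    (hr : Function.Injective r) (hr0 : ∀ a, (kernelPoly z p I c).eval (r a) = 0) :
    (kernelPoly z p I c).roots = Finset.univ.val.map r ∧
    ∃ l ≠ 0, kernelPoly z p I c = Polynomial.C l *
      ((∏ i, (Polynomial.X - Polynomial.C (r (Sum.inl i)))) *
        ∏ j, (Polynomial.X - Polynomial.C (r (Sum.inr j)))) := by
  obtain ⟨h1, l, hl, h2⟩ := exists_eq_C_mul_prod (kernelPoly_ne_zero hIc hp h)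
    (Finset.univ.map ⟨r, hr⟩) (by simpa only [Finset.forall_mem_map] using! fun a _ => hr0 a)
    (by simpa using natDegree_kernelPoly_le hId)
  refine ⟨h1, l, hl, ?_⟩
  rw [h2, Finset.prod_map, Fintype.prod_sum_type]
  rfl

end KernelPoly

/-! ### Extension of a finite solution to a bounded solution on ℤ -/

section Extension

variable {K : Type*} [Field K] {z : HahnSeries ℚ K} {p : ℤ → HahnSeries ℚ K} {I : Finset ℤ}
  {c d : ℕ}

/-- Division by the kernel of a polynomial that vanishes at the small roots. -/
theorem exists_bounded_kernel_div (hIc : ∀ i ∈ I, -(c : ℤ) ≤ i) (hId : ∀ i ∈ I, i ≤ d)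
    (hp : ∀ i ∉ I, p i = 0) (h : 1 - z * p 0 ≠ 0) (r : Fin c ⊕ Fin d → HahnSeries ℚ K)
    (hr : Function.Injective r) (hr0 : ∀ a, (kernelPoly z p I c).eval (r a) = 0)
    (hv0 : ∀ j, r (Sum.inr j) ≠ 0) (hv : ∀ j, 0 ≤ ((r (Sum.inr j))⁻¹).orderTop)
    (A : Polynomial (HahnSeries ℚ K)) (hA : ∀ i, A.eval (r (Sum.inl i)) = 0) :
    ∃ H : PowerSeries (HahnSeries ℚ K), IsBoundedFamily (fun n => PowerSeries.coeff n H) ∧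
      (kernelPoly z p I c : PowerSeries (HahnSeries ℚ K)) * H = A := by
  obtain ⟨-, l, hl, hk⟩ := exists_kernelPoly_eq_prod hIc hId hp h r hr hr0
  -- Linear factors of distinct roots are coprime, so vanishing at each small root gives
  -- divisibility by the product. What remains of the kernel is a constant and the factors of the
  -- large roots.
  obtain ⟨G, hG⟩ : (∏ i, (Polynomial.X - Polynomial.C (r (Sum.inl i)))) ∣ A :=
    Finset.prod_dvd_of_coprime
      (fun i _ j _ hij => Polynomial.isCoprime_X_sub_C_of_isUnit_sub
        (sub_ne_zero.2 fun h => hij (Sum.inl_injective (hr h))).isUnit)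
      fun i _ => Polynomial.dvd_iff_isRoot.2 (hA i)
  obtain ⟨g, hg, hg1⟩ := exists_bounded_inv_prod Finset.univ hv0 hv
  refine ⟨((G * Polynomial.C l⁻¹ : Polynomial _) : PowerSeries _) * g,
    isBoundedFamily_coeff_mul (isBoundedFamily_coeff_coe _) hg, ?_⟩
  have hprod : ((∏ j, (Polynomial.X - Polynomial.C (r (Sum.inr j))) : Polynomial _) :
      PowerSeries (HahnSeries ℚ K)) = ∏ j, (PowerSeries.X - PowerSeries.C (r (Sum.inr j))) := by
    rw [← Polynomial.coeToPowerSeries.ringHom_apply, map_prod]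
    simp
  rw [hk, hG]
  push_cast
  rw [hprod]
  have hl1 : (PowerSeries.C l * PowerSeries.C l⁻¹ : PowerSeries (HahnSeries ℚ K)) = 1 := by
    rw [← map_mul, mul_inv_cancel₀ hl, map_one]
  linear_combination
    ((∏ i, (Polynomial.X - Polynomial.C (r (Sum.inl i))) : Polynomial _) :
      PowerSeries (HahnSeries ℚ K)) * (G : PowerSeries (HahnSeries ℚ K)) *
      (PowerSeries.C l * PowerSeries.C l⁻¹ * hg1 + hl1)

/-- Solves `(1 - zP) y = ∑_{m>0} e_m u^m` above altitude `c`. If `H` is the quotient of `∑ e_{n+1}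
u^n` by the kernel `u^c (1 - zP)`, then `y = u^{c+1} H` works. -/
theorem exists_bounded_correction (hIc : ∀ i ∈ I, -(c : ℤ) ≤ i) (hId : ∀ i ∈ I, i ≤ d)
    (hp : ∀ i ∉ I, p i = 0) (h : 1 - z * p 0 ≠ 0) (r : Fin c ⊕ Fin d → HahnSeries ℚ K)
    (hr : Function.Injective r) (hr0 : ∀ a, r a ≠ 0)
    (hroot : ∀ a, z * ∑ i ∈ I, p i * r a ^ i = 1)
    (hv : ∀ j, 0 ≤ ((r (Sum.inr j))⁻¹).orderTop) (N : ℕ) (e : ℤ → HahnSeries ℚ K)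
    (heN : ∀ m, (N : ℤ) < m → e m = 0)
    (he : ∀ i, ∑ m ∈ Finset.Icc 1 (N : ℤ), e m * r (Sum.inl i) ^ m = 0) :
    ∃ y : ℤ → HahnSeries ℚ K, IsBoundedFamily y ∧ (∀ k ≤ (c : ℤ), y k = 0) ∧
      ∀ m, 0 < m → y m - z * ∑ i ∈ I, p i * y (m - i) = e m := by
  obtain ⟨H, hHb, hH⟩ := exists_bounded_kernel_div hIc hId hp h r hr
    (fun a => (eval_kernelPoly_eq_zero_iff hIc (hr0 a)).2 (hroot a)) (fun j => hr0 _) hv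
    (∑ n ∈ Finset.range N, Polynomial.C (e (n + 1)) * Polynomial.X ^ n) (by
      intro i
      -- One power of `u` has been divided out of the residual, which does not affect its vanishing
      -- at a nonzero root.
      refine (mul_eq_zero.1 (?_ : r (Sum.inl i) * _ = 0)).resolve_left (hr0 _)
      rw [← he i, Polynomial.eval_finsetSum, Finset.mul_sum]
      refine Finset.sum_nbij' (fun n => (n : ℤ) + 1) (fun m => (m - 1).toNat) ?_ ?_ ?_ ?_ ?_
      · intro n hn; simp at hn ⊢; omega
      · intro m hm; simp at hm ⊢; omega
      · intro n _; simp
      · intro m hm; simp at hm ⊢; omega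
      · intro n _
        rw [zpow_add_one₀ (hr0 _)]
        simp
        ring)
  refine ⟨fun k => if (c : ℤ) < k then PowerSeries.coeff (k - c - 1).toNat H else 0,
    (hHb.comp fun k : ℤ => (k - c - 1).toNat).ite_zero _, fun k hk => if_neg hk.not_gt, ?_⟩
  intro m hm
  obtain ⟨n, rfl⟩ : ∃ n : ℕ, m = n + 1 := ⟨(m - 1).toNat, by omega⟩
  have key := congrArg (PowerSeries.coeff n) hH
  have hpow (k : ℕ) : PowerSeries.coeff n (PowerSeries.X ^ k * H) =
      if k ≤ n then PowerSeries.coeff (n - k) H else 0 := PowerSeries.coeff_X_pow_mul' _ _ _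
  rw [kernelPoly] at key
  push_cast at key
  rw [sub_mul, mul_assoc, map_sub, PowerSeries.coeff_C_mul, hpow,
    ← Polynomial.coeToPowerSeries.ringHom_apply, map_sum, Finset.sum_mul, map_sum] at key
  simp only [Polynomial.coeToPowerSeries.ringHom_apply, Polynomial.coe_mul, Polynomial.coe_C,
    Polynomial.coe_pow, Polynomial.coe_X, mul_assoc, PowerSeries.coeff_C_mul, hpow,
    Polynomial.finsetSum_coeff, Polynomial.coeff_C_mul, Polynomial.coeff_X_pow] at key
  have hR : ∑ b ∈ Finset.range N, e ((b : ℤ) + 1) * (if n = b then 1 else 0) = e ((n : ℤ) + 1) := by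
    by_cases hn : n < N
    · simp [hn]
    · rw [heN _ (by omega)]
      refine Finset.sum_eq_zero fun b hb => ?_
      rw [if_neg (by rintro rfl; exact hn (Finset.mem_range.1 hb)), mul_zero]
  rw [hR] at key
  rw [← key]
  beta_reduce
  congr 1
  · congr 1
    · rw [eq_iff_iff]; omega
    · congr 2; omega
  · congr 1
    refine Finset.sum_congr rfl fun i hi => ?_
    have := hIc i hi
    congr 1
    by_cases h : (c : ℤ) < n + 1 - i
    · rw [if_pos h, if_pos (by omega)]
      congr 2; omega
    · rw [if_neg h, if_neg (by omega)]

end Extension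

section Extension

variable {K : Type*} [Field K] {z : HahnSeries ℚ K} {p : ℤ → HahnSeries ℚ K} {I : Finset ℤ}
  {c d : ℕ}

/-- A vector on `[-d, c]` that satisfies the equations of all roots extends to a bounded solution
on `ℤ` of the recurrence of the walks. -/
theorem exists_bounded_extension (hIc : ∀ i ∈ I, -(c : ℤ) ≤ i) (hId : ∀ i ∈ I, i ≤ d)
    (hp : ∀ i ∉ I, p i = 0) (h : 1 - z * p 0 ≠ 0) (r : Fin c ⊕ Fin d → HahnSeries ℚ K)
    (hr : Function.Injective r) (hr0 : ∀ a, r a ≠ 0)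
    (hroot : ∀ a, z * ∑ i ∈ I, p i * r a ^ i = 1)
    (hu : ∀ i, 0 ≤ (r (Sum.inl i)).orderTop)
    (hv : ∀ j, 0 ≤ ((r (Sum.inr j))⁻¹).orderTop) (q : HahnSeries ℚ K)
    (x e : ℤ → HahnSeries ℚ K) (hx : ∀ k, ¬ (-(d : ℤ) ≤ k ∧ k ≤ c) → x k = 0)
    (he : ∀ m, e m = z * ∑ i ∈ I, p i * crossingFactor q (m - i) m * x (m - i) - x m)
    (hsmall : ∀ i, ∑ m ∈ Finset.Icc 1 (c + d : ℤ), e m * r (Sum.inl i) ^ m = 0)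
    (hlarge : ∀ j, ∑ m ∈ Finset.Icc 1 (c + d : ℤ), e (-m) * r (Sum.inr j) ^ (-m) = 0) :
    ∃ y : ℤ → HahnSeries ℚ K, IsBoundedFamily y ∧
      (∀ k, -(d : ℤ) ≤ k → k ≤ c → y k = x k) ∧
      ∀ m, y m = (if m = 0 then -e 0 else 0) +
        z * ∑ i ∈ I, p i * crossingFactor q (m - i) m * y (m - i) := by
  -- The vector `x` lives on `[-d, c]` and the jumps on `[-c, d]`, so the residual lives on `[-(c +
  -- d), c + d]`.
  have heN : ∀ m, ((c + d : ℕ) : ℤ) < m → e m = 0 := by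
    intro m hm
    push_cast at hm
    rw [he, hx m (by omega), Finset.sum_eq_zero, mul_zero, sub_zero]
    intro i hi
    have := hId i hi
    rw [hx _ (by omega), mul_zero]
  have heN' : ∀ m, ((d + c : ℕ) : ℤ) < m → e (-m) = 0 := by
    intro m hm
    push_cast at hm
    rw [he, hx (-m) (by omega), Finset.sum_eq_zero, mul_zero, sub_zero]
    intro i hi
    have := hIc i hi
    rw [hx _ (by omega), mul_zero]
  have hneg (f : ℤ → HahnSeries ℚ K) : ∑ i ∈ I.image (fun i => -i), f i = ∑ i ∈ I, f (-i) :=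
    Finset.sum_image fun i _ j _ hij => neg_injective hij
  have hmem {i : ℤ} : i ∈ I.image (fun i => -i) ↔ -i ∈ I := by
    simp [neg_eq_iff_eq_neg]
  obtain ⟨g, hgb, hg0, hg⟩ := exists_bounded_correction hIc hId hp h r hr hr0 hroot hv (c + d) e
    heN (by simpa using hsmall)
  -- The reflection `u ↦ 1/u` reverses the jumps, exchanges `c` with `d`, and turns inverses of
  -- large roots into small roots and conversely.
  obtain ⟨g', hgb', hg0', hg'⟩ := exists_bounded_correction (z := z) (p := fun i => p (-i))
    (I := I.image fun i => -i) (c := d) (d := c)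
    (fun i hi => by have := hId _ (hmem.1 hi); omega)
    (fun i hi => by have := hIc _ (hmem.1 hi); omega)
    (fun i hi => hp _ fun h => hi (hmem.2 h)) (by simpa using h)
    (fun a => (r a.swap)⁻¹)
    (fun a b hab => Sum.swap_leftInverse.injective (hr (inv_injective hab)))
    (fun a => inv_ne_zero (hr0 _))
    (fun a => by rw [hneg]; simpa using hroot a.swap)
    (fun j => by simpa using hu j) (d + c) (fun m => e (-m)) heN'
    (fun j => by simpa [add_comm] using hlarge j)
  refine ⟨fun k => x k + (g k + g' (-k)), ?_, ?_, ?_⟩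
  · exact (isBoundedFamily_of_finite x (Finset.Icc (-(d : ℤ)) c) fun k hk => hx k
      (by simpa using hk)).add (hgb.add (hgb'.comp _))
  · intro k hk hk'
    beta_reduce
    rw [hg0 k hk', hg0' _ (by omega), add_zero, add_zero]
  · intro m
    -- The correction `g` is supported above `c`, and a downward jump has amplitude at most `c`. So
    -- such a jump ends at a positive altitude, never crosses, and has crossing factor `1`. The
    -- reflected `g'` behaves likewise below `-d`.
    have h1 : ∑ i ∈ I, p i * crossingFactor q (m - i) m * (x (m - i) + (g (m - i) + g' (-(m - i))))
        = ∑ i ∈ I, p i * crossingFactor q (m - i) m * x (m - i) +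
          ((if 0 < m then ∑ i ∈ I, p i * g (m - i) else 0) +
            (if m < 0 then ∑ i ∈ I, p i * g' (-m + i) else 0)) := by
      simp only [mul_add, Finset.sum_add_distrib]
      congr 2
      · split_ifs with hm
        · refine Finset.sum_congr rfl fun i _ => ?_
          by_cases hi : m - i ≤ c
          · simp [hg0 _ hi]
          · rw [crossingFactor, if_neg (by omega), mul_one]
        · refine Finset.sum_eq_zero fun i hi => ?_
          have := hIc i hi
          rw [hg0 _ (by omega), mul_zero]
      · split_ifs with hm
        · refine Finset.sum_congr rfl fun i _ => ?_
          rw [neg_sub, neg_add_eq_sub]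
          by_cases hi : i - m ≤ d
          · rw [hg0' _ hi, mul_zero, mul_zero]
          · rw [crossingFactor, if_neg (by omega), mul_one]
        · refine Finset.sum_eq_zero fun i hi => ?_
          have := hId i hi
          rw [hg0' _ (by omega), mul_zero]
    have h2 := he m
    beta_reduce
    rw [h1]
    rcases lt_trichotomy m 0 with hm | rfl | hm
    · have h3 := hg' (-m) (by omega)
      rw [hneg] at h3
      simp only [neg_neg, sub_neg_eq_add] at h3
      rw [if_neg hm.ne, if_neg hm.not_gt, if_pos hm, hg0 m (by omega)]
      linear_combination h3 + h2
    · rw [if_pos rfl, if_neg (lt_irrefl _), if_neg (lt_irrefl _), hg0 0 (by omega),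
        hg0' _ (by omega)]
      linear_combination h2
    · have h3 := hg m hm
      rw [if_neg hm.ne', if_neg hm.not_gt, if_pos hm, hg0' (-m) (by omega)]
      linear_combination h3 + h2

end Extension

/-! ### The ambient field -/

section Ambient

theorem orderTop_embed_nonneg (f : PowerSeries Coeffs) : 0 ≤ (embed f).orderTop := by
  rw [HahnSeries.le_orderTop_iff_forall]
  intro j hj
  rw [embed, RingHom.comp_apply, HahnSeries.ofPowerSeries_apply]
  refine HahnSeries.embDomain_of_notMem_range ?_
  rintro ⟨n, rfl⟩
  have : ((n : ℚ) : WithTop ℚ) < 0 := hj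
  rw [← WithTop.coe_zero, WithTop.coe_lt_coe] at this
  exact absurd this (not_lt.2 n.cast_nonneg)

theorem embed_injective : Function.Injective embed := by
  intro f g h
  rw [embed, RingHom.comp_apply, RingHom.comp_apply] at h
  replace h := HahnSeries.ofPowerSeries_injective (Γ := ℚ) (R := BaseField) h
  ext1 n
  have := congrArg (PowerSeries.coeff n) h
  rw [PowerSeries.coeff_map, PowerSeries.coeff_map] at this
  exact IsFractionRing.injective Coeffs BaseField this

theorem embed_zVar : embed zVar = HahnSeries.single 1 1 := by
  simp [embed, zVar]

theorem embed_C (a : Coeffs) : embed (PowerSeries.C a) = HahnSeries.C (algebraMap _ _ a) := by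
  simp [embed]

theorem algebraMap_ambient (a : ℂ) :
    algebraMap ℂ Ambient a = HahnSeries.C (algebraMap ℂ BaseField a) := by
  rw [HahnSeries.algebraMap_apply', PowerSeries.algebraMap_apply, HahnSeries.ofPowerSeries_C]

theorem embed_C_C (a : ℂ) : embed (PowerSeries.C (LaurentPolynomial.C (Polynomial.C a))) =
    algebraMap ℂ Ambient a := by
  rw [embed_C, algebraMap_ambient, IsScalarTower.algebraMap_apply ℂ Coeffs BaseField]
  rfl

theorem orderTop_algebraMap_nonneg (a : ℂ) : 0 ≤ (algebraMap ℂ Ambient a).orderTop := by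
  rw [← embed_C_C]
  exact orderTop_embed_nonneg _

theorem one_le_orderTop_zVar : 1 ≤ (embed zVar).orderTop := by
  rw [embed_zVar]
  exact HahnSeries.orderTop_single_le

/-- The inclusion of the series in `z` over `ℂ` in the ambient field, as a ring homomorphism. -/
def embedRootHom : HahnSeries ℚ ℂ →+* Ambient where
  toFun := embedRoot
  map_zero' := by ext; simp [embedRoot]
  map_one' := by
    ext n
    simp [embedRoot, HahnSeries.coeff_one, apply_ite (algebraMap ℂ BaseField)]
  map_add' x y := by ext; simp [embedRoot]
  map_mul' x y := HahnSeries.map_mul (algebraMap ℂ BaseField : ℂ →ₙ+* BaseField)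

theorem orderTop_embedRoot (x : HahnSeries ℚ ℂ) : (embedRoot x).orderTop = x.orderTop := by
  refine le_antisymm ?_ ?_ <;> refine HahnSeries.le_orderTop_iff_forall.2 fun j hj => ?_
  · have h : (algebraMap ℂ BaseField) (x.coeff j) = 0 :=
      HahnSeries.coeff_eq_zero_of_lt_orderTop hj
    exact (map_eq_zero _).1 h
  · exact (congrArg (algebraMap ℂ BaseField)
      (HahnSeries.coeff_eq_zero_of_lt_orderTop hj)).trans (map_zero _)

theorem embedRootHom_single (n : ℚ) (a : ℂ) :
    embedRootHom (HahnSeries.single n a) = HahnSeries.single n (algebraMap ℂ BaseField a) :=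
  HahnSeries.map_single (algebraMap ℂ BaseField : ZeroHom ℂ BaseField)

theorem embedRootHom_C (a : ℂ) : embedRootHom (HahnSeries.C a) = algebraMap ℂ Ambient a := by
  rw [algebraMap_ambient]
  exact embedRootHom_single 0 a

theorem embedRootHom_z : embedRootHom (HahnSeries.single 1 1) = embed zVar := by
  rw [embed_zVar, embedRootHom_single, map_one]

theorem altitudeSeries_eq (P : ℂ[T;T⁻¹]) (k : ℤ) :
    altitudeSeries P k = (if k = 0 then 1 else 0) + embed zVar * ∑ i ∈ P.coeff.support,
      algebraMap ℂ Ambient (P.coeff i) * crossingFactor (embed qVar) (k - i) k *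
        altitudeSeries P (k - i) := by
  have h := congrArg (fun f => embed (inclAltitude f)) (altitudeGF_eq P k)
  beta_reduce at h
  rw [altitudeSeries, h, map_add, map_add, map_mul, map_mul, map_sum, map_sum]
  congr 1
  · split_ifs <;> simp
  · congr 1
    · simp [inclAltitude, zVar]
    · refine Finset.sum_congr rfl fun i _ => ?_
      rw [map_mul, map_mul, map_mul, map_mul, altitudeSeries]
      congr 2
      · rw [← embed_C_C, inclAltitude, PowerSeries.map_C]
      · unfold crossingFactor
        split_ifs
        · simp [inclAltitude, qVar]
        · simp

end Ambient

/-! ### Existence of the roots of the kernel -/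

section Roots

theorem exists_injective_pow_eq {c : ℕ} (hc : 0 < c) {b : ℂ} (hb : b ≠ 0) :
    ∃ a : Fin c → ℂ, Function.Injective a ∧ ∀ i, a i ^ c = b := by
  obtain ⟨a, ha⟩ := IsAlgClosed.exists_pow_nat_eq b hc
  have ha0 : a ≠ 0 := by rintro rfl; rw [zero_pow hc.ne'] at ha; exact hb ha.symm
  have hζ := Complex.isPrimitiveRoot_exp c hc.ne'
  refine ⟨fun i => a * Complex.exp (2 * Real.pi * Complex.I / c) ^ i.val, fun i j hij => ?_,
    fun i => ?_⟩
  · exact Fin.ext (hζ.pow_inj i.2 j.2 (mul_left_cancel₀ ha0 hij))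
  · rw [mul_pow, ha, ← pow_mul, mul_comm i.val, pow_mul, hζ.pow_eq_one, one_pow, mul_one]

/-- Hensel's lemma for power series. -/
theorem exists_powerSeries_root {k : Type*} [Field k] {f : Polynomial (PowerSeries k)}
    (hf : f.Monic) {a : k} (h0 : (f.map PowerSeries.constantCoeff).eval a = 0)
    (h1 : (f.map PowerSeries.constantCoeff).derivative.eval a ≠ 0) :
    ∃ s : PowerSeries k, f.eval s = 0 ∧ PowerSeries.constantCoeff s = a := by
  have hev (g : Polynomial (PowerSeries k)) : PowerSeries.constantCoeff (g.eval (PowerSeries.C a)) =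
      (g.map PowerSeries.constantCoeff).eval a := by
    rw [Polynomial.eval_map, ← Polynomial.eval₂_id, Polynomial.hom_eval₂,
      PowerSeries.constantCoeff_C, RingHom.comp_id]
  obtain ⟨s, hs, hsa⟩ := HenselianRing.is_henselian (I := Ideal.span {PowerSeries.X}) f hf
    (PowerSeries.C a)
    (by rw [Ideal.mem_span_singleton, PowerSeries.X_dvd_iff, hev, h0])
    (by
      refine IsUnit.map _ (PowerSeries.isUnit_iff_constantCoeff.2 (IsUnit.mk0 _ ?_))
      rwa [hev, ← Polynomial.derivative_map])
  refine ⟨s, hs, ?_⟩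
  rw [Ideal.mem_span_singleton, PowerSeries.X_dvd_iff, map_sub, PowerSeries.constantCoeff_C] at hsa
  exact sub_eq_zero.1 hsa

/-- The substitution `z ↦ z^(1/c)`. -/
def ramify (c : ℕ) (hc : 0 < c) : PowerSeries ℂ →+* HahnSeries ℚ ℂ :=
  (HahnSeries.embDomainRingHom ((AddMonoidHom.mulLeft (1 / c : ℚ)).comp (Nat.castAddMonoidHom ℚ))
    (fun a b h => by
      have : (c : ℚ) ≠ 0 := by positivity
      simpa [this] using h)
    (fun a b => by
      have : (0 : ℚ) < 1 / c := by positivity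
      simp only [AddMonoidHom.comp_apply, AddMonoidHom.coe_mulLeft, Nat.coe_castAddMonoidHom]
      rw [mul_le_mul_iff_right₀ this, Nat.cast_le])).comp
    HahnSeries.toPowerSeries.symm.toRingHom

variable {c : ℕ} (hc : 0 < c)

theorem ramify_injective : Function.Injective (ramify c hc) :=
  HahnSeries.embDomain_injective.comp HahnSeries.toPowerSeries.symm.injective

theorem ramify_C (a : ℂ) : ramify c hc (PowerSeries.C a) = HahnSeries.C a := by
  rw [ramify, RingHom.comp_apply]
  have : HahnSeries.toPowerSeries.symm.toRingHom (PowerSeries.C a) =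
      (HahnSeries.C a : HahnSeries ℕ ℂ) := by
    ext n
    simp [HahnSeries.C_apply, HahnSeries.coeff_single, PowerSeries.coeff_C]
  rw [this]
  exact HahnSeries.embDomainRingHom_C

theorem ramify_X : ramify c hc PowerSeries.X = HahnSeries.single (1 / c : ℚ) 1 := by
  rw [ramify, RingHom.comp_apply]
  have : HahnSeries.toPowerSeries.symm.toRingHom PowerSeries.X =
      (HahnSeries.single 1 1 : HahnSeries ℕ ℂ) := by
    ext n
    simp [HahnSeries.coeff_single, PowerSeries.coeff_X]
  rw [this]
  refine HahnSeries.embDomain_single.trans ?_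
  simp

theorem orderTop_ramify_nonneg (f : PowerSeries ℂ) : 0 ≤ (ramify c hc f).orderTop := by
  rw [HahnSeries.le_orderTop_iff_forall]
  intro j hj
  refine HahnSeries.embDomain_of_notMem_range ?_
  rintro ⟨n, rfl⟩
  have h2 : (((1 / c : ℚ) * n : ℚ) : WithTop ℚ) < 0 := hj
  rw [← WithTop.coe_zero, WithTop.coe_lt_coe] at h2
  exact absurd h2 (not_lt.2 (by positivity))

/-- Put `z = T^c` and `u = T/s`. The equation times `s^d` becomes `∑ p_i T^(c+i) s^(d-i) = s^d`,
which at `T = 0` reduces to `p_{-c} s^(c+d) = s^d`. Its `c` nonzero solutions are simple and lift by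
Hensel's lemma. -/
theorem exists_small_roots (p : ℤ → ℂ) (I : Finset ℤ) (c d : ℕ) (hIc : ∀ i ∈ I, -(c : ℤ) ≤ i)
    (hId : ∀ i ∈ I, i ≤ d) (hp : 0 < c → -(c : ℤ) ∈ I ∧ p (-c) ≠ 0) :
    ∃ u : Fin c → HahnSeries ℚ ℂ, Function.Injective u ∧ ∀ j, u j ≠ 0 ∧ 0 < (u j).orderTop ∧
      HahnSeries.single 1 1 * ∑ i ∈ I, HahnSeries.C (p i) * u j ^ i = 1 := by
  rcases Nat.eq_zero_or_pos c with rfl | hc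
  · exact ⟨fun i => i.elim0, fun i => i.elim0, fun i => i.elim0⟩
  obtain ⟨hcI, hp0⟩ := hp hc
  obtain ⟨a, ha, hac⟩ := exists_injective_pow_eq hc (inv_ne_zero hp0)
  have ha0 : ∀ i, a i ≠ 0 := fun i h => by
    have := hac i
    rw [h, zero_pow hc.ne'] at this
    exact inv_ne_zero hp0 this.symm
  let g : Polynomial (PowerSeries ℂ) := Polynomial.X ^ d - ∑ i ∈ I.erase (-c),
    Polynomial.C (PowerSeries.C (p i) * PowerSeries.X ^ (i + (c : ℤ)).toNat) *
      Polynomial.X ^ ((d : ℤ) - i).toNat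
  -- The equation for `s`, divided by `p_{-c}` to make it monic: every other jump has `d - i < c +
  -- d`.
  let f : Polynomial (PowerSeries ℂ) :=
    Polynomial.X ^ (c + d) - Polynomial.C (PowerSeries.C (p (-c))⁻¹) * g
  have hfm : f.Monic := by
    refine Polynomial.monic_X_pow_sub ?_
    refine Polynomial.degree_lt_iff_coeff_zero _ _ |>.2 fun m hm => ?_
    have h1 : ∀ i ∈ I.erase (-c), m ≠ ((d : ℤ) - i).toNat := fun i hi => by
      have := hIc i (Finset.mem_of_mem_erase hi)
      have := hId i (Finset.mem_of_mem_erase hi)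
      have := Finset.ne_of_mem_erase hi
      omega
    rw [Polynomial.coeff_C_mul, Polynomial.coeff_sub, Polynomial.coeff_X_pow, if_neg (by omega),
      Polynomial.finsetSum_coeff, Finset.sum_eq_zero, sub_zero, mul_zero]
    intro i hi
    rw [Polynomial.coeff_C_mul_X_pow, if_neg (h1 i hi)]
  have hfmap : f.map PowerSeries.constantCoeff =
      Polynomial.X ^ (c + d) - Polynomial.C (p (-c))⁻¹ * Polynomial.X ^ d := by
    have : ∑ i ∈ I.erase (-c), Polynomial.map PowerSeries.constantCoeff
        (Polynomial.C (PowerSeries.C (p i) * PowerSeries.X ^ (i + (c : ℤ)).toNat) *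
          Polynomial.X ^ ((d : ℤ) - i).toNat) = 0 := by
      refine Finset.sum_eq_zero fun i hi => ?_
      have := hIc i (Finset.mem_of_mem_erase hi)
      have := Finset.ne_of_mem_erase hi
      have h2 : (i + (c : ℤ)).toNat ≠ 0 := by omega
      simp [h2]
    simp only [f, g, Polynomial.map_sub, Polynomial.map_mul, Polynomial.map_pow, Polynomial.map_X,
      Polynomial.map_C, PowerSeries.constantCoeff_C, Polynomial.map_sum] at this ⊢
    rw [this, sub_zero]
  have hroot : ∀ j, ∃ s : PowerSeries ℂ, f.eval s = 0 ∧ PowerSeries.constantCoeff s = a j := by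
    intro j
    refine exists_powerSeries_root hfm ?_ ?_
    · rw [hfmap]
      simp [pow_add, hac]
    · rw [hfmap]
      intro h
      -- The derivative at `a j` is multiplied by `a j` to restore the full exponents; then `a j ^ c
      -- = 1/p_{-c}` makes the terms with factor `d` cancel.
      have h2 : a j * 0 = c * a j ^ (c + d) := by
        rw [← h]
        simp only [Polynomial.derivative_sub, Polynomial.derivative_X_pow,
          Polynomial.derivative_C_mul, Polynomial.eval_sub, Polynomial.eval_mul, Polynomial.eval_C,
          Polynomial.eval_pow, Polynomial.eval_X, ← hac j]
        rcases d with _ | d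
        · obtain ⟨c, rfl⟩ : ∃ c', c = c' + 1 := ⟨c - 1, by omega⟩
          simp
          ring
        · have : c + (d + 1) - 1 = c + d := rfl
          rw [this, Nat.add_sub_cancel]
          push_cast
          ring
      rw [mul_zero] at h2
      exact mul_ne_zero (Nat.cast_ne_zero.2 hc.ne') (pow_ne_zero _ (ha0 j)) h2.symm
  choose s hs hsa using hroot
  have hσ0 : ∀ j, ramify c hc (s j) ≠ 0 := fun j h => by
    have := ramify_injective hc (h.trans (map_zero _).symm)
    have h2 := hsa j
    rw [this, map_zero] at h2
    exact ha0 j h2.symm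
  have hT : ramify c hc PowerSeries.X ≠ 0 := fun h =>
    PowerSeries.X_ne_zero (ramify_injective hc (h.trans (map_zero _).symm))
  have hTc : ramify c hc PowerSeries.X ^ c = HahnSeries.single 1 1 := by
    have : (c : ℚ) ≠ 0 := Nat.cast_ne_zero.2 hc.ne'
    rw [ramify_X, HahnSeries.single_pow]
    simp [this]
  refine ⟨fun j => ramify c hc PowerSeries.X * (ramify c hc (s j))⁻¹, fun i j hij => ?_,
    fun j => ⟨mul_ne_zero hT (inv_ne_zero (hσ0 j)), ?_, ?_⟩⟩
  · have h1 := ramify_injective hc (inv_injective (mul_left_cancel₀ hT hij))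
    exact ha (by rw [← hsa i, h1, hsa j])
  · have hinv : (ramify c hc (s j))⁻¹ = ramify c hc (s j)⁻¹ := by
      refine inv_eq_of_mul_eq_one_right ?_
      rw [← map_mul, PowerSeries.mul_inv_cancel _ (by rw [hsa]; exact ha0 j), map_one]
    beta_reduce
    rw [hinv, HahnSeries.orderTop_mul, ramify_X, HahnSeries.orderTop_single one_ne_zero]
    refine lt_of_lt_of_le ?_ (le_add_of_nonneg_right (orderTop_ramify_nonneg hc _))
    rw [← WithTop.coe_zero, WithTop.coe_lt_coe]
    positivity
  · set σ := ramify c hc (s j) with hσ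
    set T := ramify c hc PowerSeries.X with hT'
    have h1 := congrArg (ramify c hc) (hs j)
    simp only [f, g, Polynomial.eval_sub, Polynomial.eval_pow, Polynomial.eval_X,
      Polynomial.eval_mul, Polynomial.eval_C, Polynomial.eval_finsetSum, map_sub, map_pow, map_mul,
      map_sum, map_zero, ramify_C, ← hσ, ← hT'] at h1
    have h2 : σ ^ d = ∑ i ∈ I, HahnSeries.C (p i) * T ^ (i + (c : ℤ)).toNat *
        σ ^ ((d : ℤ) - i).toNat := by
      rw [← Finset.add_sum_erase _ _ hcI]
      have h3 : ((d : ℤ) - -c).toNat = c + d := by omega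
      have h4 : (-(c : ℤ) + c).toNat = 0 := by omega
      rw [h3, h4]
      have h5 : (HahnSeries.C (p (-c)) * HahnSeries.C (p (-c))⁻¹ : HahnSeries ℚ ℂ) = 1 := by
        rw [← map_mul, mul_inv_cancel₀ hp0, map_one]
      linear_combination (-HahnSeries.C (p (-c))) * h1 - (σ ^ d -
        ∑ i ∈ I.erase (-c), HahnSeries.C (p i) * T ^ (i + (c : ℤ)).toNat *
        σ ^ ((d : ℤ) - i).toNat) * h5
    refine mul_right_cancel₀ (pow_ne_zero d (hσ0 j)) ?_
    rw [one_mul]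
    refine Eq.trans ?_ h2.symm
    rw [← hTc, Finset.mul_sum, Finset.sum_mul]
    refine Finset.sum_congr rfl fun i hi => ?_
    have := hIc i hi
    have := hId i hi
    rw [← zpow_natCast T (i + (c : ℤ)).toNat, ← zpow_natCast σ ((d : ℤ) - i).toNat,
      Int.toNat_of_nonneg (by omega), Int.toNat_of_nonneg (by omega), zpow_add₀ hT,
      zpow_sub₀ (hσ0 j), mul_zpow, inv_zpow, zpow_natCast, zpow_natCast]
    ring

theorem coeff_neg_maxDown_ne_zero {P : ℂ[T;T⁻¹]} (h : 0 < maxDown P) :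
    P.coeff (-(maxDown P : ℤ)) ≠ 0 := by
  have hne : P.coeff.support.Nonempty := by
    by_contra h0
    rw [Finset.not_nonempty_iff_eq_empty] at h0
    simp [maxDown, h0] at h
  obtain ⟨i, hi, h1⟩ := Finset.exists_mem_eq_sup _ hne fun i : ℤ => (-i).toNat
  rw [← maxDown] at h1
  have : -(maxDown P : ℤ) = i := by omega
  rw [this]
  exact Finsupp.mem_support_iff.1 hi

theorem coeff_maxUp_ne_zero {P : ℂ[T;T⁻¹]} (h : 0 < maxUp P) : P.coeff (maxUp P) ≠ 0 := by
  have hne : P.coeff.support.Nonempty := by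
    by_contra h0
    rw [Finset.not_nonempty_iff_eq_empty] at h0
    simp [maxUp, h0] at h
  obtain ⟨i, hi, h1⟩ := Finset.exists_mem_eq_sup _ hne fun i : ℤ => i.toNat
  rw [← maxUp] at h1
  have : (maxUp P : ℤ) = i := by omega
  rw [this]
  exact Finsupp.mem_support_iff.1 hi

theorem kernel_eq_kernelPoly (P : ℂ[T;T⁻¹]) : kernel P = kernelPoly (HahnSeries.single 1 1)
    (fun i => HahnSeries.C (P.coeff i)) P.coeff.support (maxDown P) := rfl

theorem one_sub_single_mul_C_ne_zero {k : Type*} [Field k] (a : k) :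
    (1 : HahnSeries ℚ k) - HahnSeries.single 1 1 * HahnSeries.C a ≠ 0 := by
  intro h
  have := congrArg (fun x : HahnSeries ℚ k => x.coeff 0) h
  simp [HahnSeries.C_apply] at this

theorem map_sumElim_univ {α β γ : Type*} [Fintype α] [Fintype β] (u : α → γ) (v : β → γ) :
    Finset.univ.val.map (Sum.elim u v) = Finset.univ.val.map u + Finset.univ.val.map v := by
  rw [← Finset.univ_disjSum_univ]
  simp [Finset.disjSum, Multiset.disjSum]

/-- The large roots are the inverses of the small roots for `P(1/u)`. The sign of the order
separates them from the small roots, so all `c + d` roots are distinct. -/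
theorem exists_isKernelRoots (P : ℂ[T;T⁻¹]) :
    ∃ u v, IsKernelRoots P u v ∧ Function.Injective (Sum.elim u v) ∧ ∀ a, Sum.elim u v a ≠ 0 := by
  have hIc : ∀ i ∈ P.coeff.support, -(maxDown P : ℤ) ≤ i := fun i hi =>
    neg_maxDown_le (Finsupp.mem_support_iff.1 hi)
  have hId : ∀ i ∈ P.coeff.support, i ≤ maxUp P := fun i hi =>
    le_maxUp (Finsupp.mem_support_iff.1 hi)
  have hneg (f : ℤ → HahnSeries ℚ ℂ) :
      ∑ i ∈ P.coeff.support.image (fun i => -i), f i = ∑ i ∈ P.coeff.support, f (-i) :=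
    Finset.sum_image fun i _ j _ hij => neg_injective hij
  obtain ⟨u, hu, hu1⟩ := exists_small_roots (fun i => P.coeff i) P.coeff.support (maxDown P)
    (maxUp P) hIc hId fun h => ⟨Finsupp.mem_support_iff.2 (coeff_neg_maxDown_ne_zero h),
      coeff_neg_maxDown_ne_zero h⟩
  obtain ⟨v, hv, hv1⟩ := exists_small_roots (fun i => P.coeff (-i))
    (P.coeff.support.image fun i => -i) (maxUp P) (maxDown P)
    (by simpa using hId)
    (by simpa [neg_le] using hIc)
    fun h => by simpa using coeff_maxUp_ne_zero h
  simp only [hneg, neg_neg] at hv1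
  have hlarge : ∀ j, ((v j)⁻¹).orderTop < 0 := by
    intro j
    by_contra h
    have h1 := HahnSeries.orderTop_mul (v j) (v j)⁻¹
    rw [mul_inv_cancel₀ (hv1 j).1, HahnSeries.orderTop_one] at h1
    exact absurd h1 ((hv1 j).2.1.trans_le (le_add_of_nonneg_right (not_lt.1 h))).ne
  have hinj : Function.Injective (Sum.elim u fun j => (v j)⁻¹) :=
    hu.sumElim (inv_injective.comp hv) fun i j h =>
      absurd (h ▸ (hu1 i).2.1) (hlarge j).not_gt
  refine ⟨u, fun j => (v j)⁻¹, ⟨fun i => (hu1 i).2.1, hlarge, ?_⟩, hinj, ?_⟩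
  swap
  · rintro (i | j)
    · exact (hu1 i).1
    · exact inv_ne_zero (hv1 j).1
  have h := (exists_kernelPoly_eq_prod hIc hId (z := HahnSeries.single 1 1)
    (p := fun i => HahnSeries.C (P.coeff i))
    (fun i hi => by simp [Finsupp.notMem_support_iff.1 hi]) (one_sub_single_mul_C_ne_zero _)
    (Sum.elim u fun j => (v j)⁻¹) hinj (by
      rintro (i | j)
      · exact (eval_kernelPoly_eq_zero_iff hIc (hu1 i).1).2 (hu1 i).2.2
      · exact (eval_kernelPoly_eq_zero_iff hIc (inv_ne_zero (hv1 j).1)).2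
          (by simpa using (hv1 j).2.2))).1
  rw [kernel_eq_kernelPoly, h, map_sumElim_univ]

variable {P : ℂ[T;T⁻¹]} {u : Fin (maxDown P) → HahnSeries ℚ ℂ} {v : Fin (maxUp P) → HahnSeries ℚ ℂ}

/-- Any listing has the same multiset of roots as the one constructed above, which has no
repetition. -/
theorem IsKernelRoots.injective (h : IsKernelRoots P u v) : Function.Injective (Sum.elim u v) := by
  obtain ⟨u', v', h', hinj, -⟩ := exists_isKernelRoots P
  have h1 : (Finset.univ.val.map (Sum.elim u v)).Nodup := by
    rw [map_sumElim_univ, ← h.roots_eq, h'.roots_eq, ← map_sumElim_univ]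
    exact (Multiset.nodup_map_iff_of_injective hinj).2 Finset.univ.nodup
  exact fun a b hab => Multiset.inj_on_of_nodup_map h1 a (Finset.mem_univ_val a) b
    (Finset.mem_univ_val b) hab

theorem IsKernelRoots.mem_roots (h : IsKernelRoots P u v) (a : Fin (maxDown P) ⊕ Fin (maxUp P)) :
    Sum.elim u v a ∈ (kernel P).roots := by
  rw [h.roots_eq, ← map_sumElim_univ]
  exact Multiset.mem_map_of_mem _ (Finset.mem_univ_val a)

theorem IsKernelRoots.ne_zero (h : IsKernelRoots P u v) (a : Fin (maxDown P) ⊕ Fin (maxUp P)) :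
    Sum.elim u v a ≠ 0 := by
  obtain ⟨u', v', h', -, h0⟩ := exists_isKernelRoots P
  have h1 := h.mem_roots a
  rw [h'.roots_eq, ← map_sumElim_univ] at h1
  obtain ⟨b, -, hb⟩ := Multiset.mem_map.1 h1
  rw [← hb]
  exact h0 b

theorem IsKernelRoots.equation (h : IsKernelRoots P u v) (a : Fin (maxDown P) ⊕ Fin (maxUp P)) :
    HahnSeries.single 1 1 * ∑ i ∈ P.coeff.support, HahnSeries.C (P.coeff i) * Sum.elim u v a ^ i
      = 1 :=
  (eval_kernelPoly_eq_zero_iff (fun _ hi => neg_maxDown_le (Finsupp.mem_support_iff.1 hi))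
    (h.ne_zero a)).1 (Polynomial.isRoot_of_mem_roots (h.mem_roots a))

end Roots

/-! ### Linear systems and recurrences over a subfield -/

section Subfield

variable {F : Type*} [Field F]

theorem mulVec_surjective_of_injective {m n : Type*} [Fintype m] [Fintype n] {M : Matrix m n F}
    (hM : Function.Injective M.mulVec) (hcard : Fintype.card m = Fintype.card n) :
    Function.Surjective M.mulVec :=
  (LinearMap.injective_iff_surjective_of_finrank_eq_finrank (f := M.mulVecLin)
    (by simp [hcard])).1 hM

/-- The solution of a nonsingular system with coefficients in a subfield lies in the subfield. -/
theorem mem_of_mulVec_eq {m n : Type*} [Fintype m] [Fintype n] {k : Type*} [Field k] [Algebra k F]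
    (S : IntermediateField k F) (M : Matrix m n F) (hM : ∀ i j, M i j ∈ S)
    (hinj : Function.Injective M.mulVec) (hcard : Fintype.card m = Fintype.card n)
    (b : m → F) (hb : ∀ i, b i ∈ S) (x : n → F) (hx : M.mulVec x = b) (j : n) : x j ∈ S := by
  classical
  let M' : Matrix m n S := Matrix.of fun i j => ⟨M i j, hM i j⟩
  have hmap (y : n → S) : M.mulVec (fun j => (y j : F)) = fun i => ((M'.mulVec y i : S) : F) := by
    ext i
    simp [Matrix.mulVec, dotProduct, M']
  -- Injectivity over the large field restricts to the subfield. There the matrix is still square,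
  -- so a solution exists in the subfield, and it is the solution by injectivity.
  have hinj' : Function.Injective M'.mulVec := by
    intro y y' h
    have h1 := hinj ((hmap y).trans ((congrArg (fun (f : m → S) i => (f i : F)) h).trans
      (hmap y').symm))
    ext j
    exact congrFun h1 j
  obtain ⟨y, hy⟩ := mulVec_surjective_of_injective hinj' hcard fun i => (⟨b i, hb i⟩ : S)
  have h2 : x = fun j => (y j : F) := by
    apply hinj
    rw [hx, hmap]
    ext i
    exact (congrArg Subtype.val (congrFun hy i)).symm
  rw [h2]
  exact (y j).2

/-- A sequence that solves the recurrence of the kernel with initial values in a subfield. -/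
theorem mem_of_recurrence {S : Type*} [SetLike S F] [SubfieldClass S F] (s : S) {z : F}
    {p : ℤ → F} {I : Finset ℤ} {c d : ℕ} (hIc : ∀ i ∈ I, -(c : ℤ) ≤ i) (hId : ∀ i ∈ I, i ≤ d)
    (hpI : ∀ i ∉ I, p i = 0) (hz : z ∈ s) (hp : ∀ i, p i ∈ s) (h0 : c = 0 → 1 - z * p 0 ≠ 0)
    (hc : 0 < c → z * p (-c) ≠ 0) (w : ℤ → ℤ → F) (hw : ∀ i m, w i m ∈ s)
    (hw1 : ∀ i m, 0 < m → 0 ≤ m - i → w i m = 1)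
    (y : ℤ → F) (hy : ∀ m, 0 < m → y m = z * ∑ i ∈ I, p i * w i m * y (m - i))
    (hbase : ∀ k, -(d : ℤ) ≤ k → k ≤ c → y k ∈ s) (k : ℤ) (hk : -(d : ℤ) ≤ k) : y k ∈ s := by
  have key : ∀ n : ℕ, ∀ k, -(d : ℤ) ≤ k → k ≤ c + n → y k ∈ s := by
    intro n
    induction n with
    | zero => simpa using hbase
    | succ n ih =>
      intro k hk hkn
      by_cases hkn' : k ≤ c + n
      · exact ih k hk hkn'
      -- The recurrence at altitude `n + 1` is solved for its highest term, the one reached through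
      -- the jump `-c`. All other terms have altitudes already treated.
      obtain rfl : k = (n + 1 : ℤ) - -c := by push_cast at hkn; omega
      have h1 := hy (n + 1) (by omega)
      have h2 : ∑ i ∈ I.erase (-c), p i * w i (n + 1) * y (n + 1 - i) ∈ s := by
        refine sum_mem fun i hi => mul_mem (mul_mem (hp i) (hw _ _)) (ih _ ?_ ?_)
        · have := hId i (Finset.mem_of_mem_erase hi)
          omega
        · have := hIc i (Finset.mem_of_mem_erase hi)
          have := Finset.ne_of_mem_erase hi
          omega
      have h3 : ∑ i ∈ I, p i * w i (n + 1) * y (n + 1 - i) = p (-c) * y (n + 1 - -c) +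
          ∑ i ∈ I.erase (-c), p i * w i (n + 1) * y (n + 1 - i) := by
        by_cases hcI : -(c : ℤ) ∈ I
        · rw [← Finset.add_sum_erase _ _ hcI, hw1 _ _ (by omega) (by omega), mul_one]
        · rw [Finset.erase_eq_of_notMem hcI, hpI _ hcI, zero_mul, zero_add]
      rw [h3] at h1
      set σ := ∑ i ∈ I.erase (-c), p i * w i (n + 1) * y (n + 1 - i)
      rcases Nat.eq_zero_or_pos c with rfl | hc0
      -- For `c = 0` the highest term is `y (n + 1)` itself and occurs on both sides, hence the
      -- division by `1 - z p_0`.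
      · have h4 : y ((n : ℤ) + 1 - -((0 : ℕ) : ℤ)) = (1 - z * p 0)⁻¹ * (z * σ) := by
          rw [eq_inv_mul_iff_mul_eq₀ (h0 rfl)]
          simp only [Nat.cast_zero, neg_zero, sub_zero] at h1 ⊢
          linear_combination h1
        rw [h4]
        exact mul_mem (inv_mem (sub_mem (one_mem _) (mul_mem hz (hp 0)))) (mul_mem hz h2)
      · have h4 : y ((n : ℤ) + 1 - -(c : ℤ)) = (z * p (-c))⁻¹ * (y (n + 1) - z * σ) := by
          rw [eq_inv_mul_iff_mul_eq₀ (hc hc0)]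
          linear_combination -h1
        rw [h4]
        exact mul_mem (inv_mem (mul_mem hz (hp _)))
          (sub_mem (ih _ (by omega) (by omega)) (mul_mem hz h2))
  exact key (k - c).toNat k hk (by omega)

end Subfield

/-! ### The linear system -/

section System

variable (P : ℂ[T;T⁻¹])

theorem evalAt_eq_sum {L : Type*} [Field L] [Algebra ℂ L] (x : L) (f : ℂ[T;T⁻¹]) (s : Finset ℤ)
    (hs : ∀ m, f.coeff m ≠ 0 → m ∈ s) :
    evalAt x f = ∑ m ∈ s, algebraMap ℂ L (f.coeff m) * x ^ m :=
  Finsupp.sum_of_support_subset _ (fun m hm => hs m (Finsupp.mem_support_iff.1 hm)) _ (by simp)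

/-- The coefficient of `W_k` in the equation `[u^m]` of the kernel method. -/
def walkEntry (m k : ℤ) : Ambient :=
  embed zVar * (algebraMap ℂ Ambient (P.coeff (m - k)) * crossingFactor (embed qVar) k m) -
    if m = k then 1 else 0

theorem coeff_T (k m : ℤ) :
    (LaurentPolynomial.T k : ℂ[T;T⁻¹]).coeff m = if m = k then 1 else 0 := by
  rw [LaurentPolynomial.T, AddMonoidAlgebra.coeff_single, Finsupp.single_apply]
  simp only [eq_comm]

/-- The three cases of `smallEntry` are one formula: the positive part of the recurrence operator
applied to `u^k`, evaluated at `x`. A row of the system thus evaluates the positive part of a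
residual. -/
theorem smallEntry_eq_sum (x : Ambient) {k : ℤ} (hk : -(maxUp P : ℤ) ≤ k) (hk' : k ≤ maxDown P) :
    smallEntry P x k =
      ∑ m ∈ Finset.Icc 1 (maxDown P + maxUp P : ℤ), walkEntry P m k * x ^ m := by
  have h1 : evalAt x (posPart (P * LaurentPolynomial.T k)) =
      ∑ m ∈ Finset.Icc 1 (maxDown P + maxUp P : ℤ),
        algebraMap ℂ Ambient (P.coeff (m - k)) * x ^ m := by
    rw [evalAt_eq_sum x _ (Finset.Icc 1 (maxDown P + maxUp P : ℤ))]
    · refine Finset.sum_congr rfl fun m hm => ?_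
      rw [coeff_posPart, coeff_mul_T, if_pos (by have := Finset.mem_Icc.1 hm; omega)]
    · intro m hm
      rw [coeff_posPart, coeff_mul_T] at hm
      have h2 := le_maxUp (fun h : P.coeff (m - k) = 0 => hm (by rw [h, ite_self]))
      have h3 : 0 < m := by by_contra h; exact hm (if_neg h)
      exact Finset.mem_Icc.2 ⟨h3, by omega⟩
  rw [smallEntry]
  split_ifs with hk0 hk1
  · rw [h1, Finset.mul_sum]
    refine Finset.sum_congr rfl fun m hm => ?_
    have := Finset.mem_Icc.1 hm
    rw [walkEntry, crossingFactor, if_pos (by omega), if_neg (by omega)]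
    ring
  · subst hk1
    rw [LaurentPolynomial.T_zero, mul_one] at h1
    rw [h1, Finset.mul_sum]
    refine Finset.sum_congr rfl fun m hm => ?_
    have := Finset.mem_Icc.1 hm
    rw [walkEntry, crossingFactor, if_neg (by omega), if_neg (by omega)]
    ring
  · have h2 : evalAt x (posPart (LaurentPolynomial.T k)) =
        ∑ m ∈ Finset.Icc 1 (maxDown P + maxUp P : ℤ), (if m = k then 1 else 0) * x ^ m := by
      rw [evalAt_eq_sum x _ (Finset.Icc 1 (maxDown P + maxUp P : ℤ))]
      · refine Finset.sum_congr rfl fun m hm => ?_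
        rw [coeff_posPart, coeff_T, if_pos (by have := Finset.mem_Icc.1 hm; omega)]
        split_ifs <;> simp
      · intro m hm
        rw [coeff_posPart, coeff_T] at hm
        have h3 : 0 < m := by by_contra h; exact hm (if_neg h)
        have h4 : m = k := by by_contra h; exact hm (by rw [if_neg h, ite_self])
        exact Finset.mem_Icc.2 ⟨h3, by omega⟩
    rw [h1, h2, Finset.mul_sum, ← Finset.sum_sub_distrib, ← Finset.sum_neg_distrib]
    refine Finset.sum_congr rfl fun m hm => ?_
    have := Finset.mem_Icc.1 hm
    rw [walkEntry, crossingFactor, if_neg (c := _ ∨ _) (by omega)]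
    ring

theorem largeEntry_eq_sum (x : Ambient) {k : ℤ} (hk : -(maxUp P : ℤ) ≤ k) (hk' : k ≤ maxDown P) :
    largeEntry P x k =
      ∑ m ∈ Finset.Icc 1 (maxDown P + maxUp P : ℤ), walkEntry P (-m) k * x ^ (-m) := by
  have hneg (f : ℤ → Ambient) : ∑ m ∈ Finset.Icc 1 (maxDown P + maxUp P : ℤ), f (-m) =
      ∑ m ∈ Finset.Icc (-(maxDown P + maxUp P : ℤ)) (-1), f m := by
    refine Finset.sum_nbij' (fun m => -m) (fun m => -m) ?_ ?_ ?_ ?_ ?_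
    · intro m hm; simp at hm ⊢; omega
    · intro m hm; simp at hm ⊢; omega
    · simp
    · simp
    · simp
  rw [hneg fun m => walkEntry P m k * x ^ m]
  have h1 : evalAt x (negPart (P * LaurentPolynomial.T k)) =
      ∑ m ∈ Finset.Icc (-(maxDown P + maxUp P : ℤ)) (-1),
        algebraMap ℂ Ambient (P.coeff (m - k)) * x ^ m := by
    rw [evalAt_eq_sum x _ (Finset.Icc (-(maxDown P + maxUp P : ℤ)) (-1))]
    · refine Finset.sum_congr rfl fun m hm => ?_
      rw [coeff_negPart, coeff_mul_T, if_pos (by have := Finset.mem_Icc.1 hm; omega)]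
    · intro m hm
      rw [coeff_negPart, coeff_mul_T] at hm
      have h2 := neg_maxDown_le (fun h : P.coeff (m - k) = 0 => hm (by rw [h, ite_self]))
      have h3 : m < 0 := by by_contra h; exact hm (if_neg h)
      exact Finset.mem_Icc.2 ⟨by omega, by omega⟩
  rw [largeEntry]
  split_ifs with hk0 hk1
  · rw [h1, Finset.mul_sum]
    refine Finset.sum_congr rfl fun m hm => ?_
    have := Finset.mem_Icc.1 hm
    rw [walkEntry, crossingFactor, if_pos (by omega), if_neg (by omega)]
    ring
  · subst hk1
    rw [LaurentPolynomial.T_zero, mul_one] at h1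
    rw [h1, Finset.mul_sum]
    refine Finset.sum_congr rfl fun m hm => ?_
    have := Finset.mem_Icc.1 hm
    rw [walkEntry, crossingFactor, if_neg (by omega), if_neg (by omega)]
    ring
  · have h2 : evalAt x (negPart (LaurentPolynomial.T k)) =
        ∑ m ∈ Finset.Icc (-(maxDown P + maxUp P : ℤ)) (-1), (if m = k then 1 else 0) * x ^ m := by
      rw [evalAt_eq_sum x _ (Finset.Icc (-(maxDown P + maxUp P : ℤ)) (-1))]
      · refine Finset.sum_congr rfl fun m hm => ?_
        rw [coeff_negPart, coeff_T, if_pos (by have := Finset.mem_Icc.1 hm; omega)]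
        split_ifs <;> simp
      · intro m hm
        rw [coeff_negPart, coeff_T] at hm
        have h3 : m < 0 := by by_contra h; exact hm (if_neg h)
        have h4 : m = k := by by_contra h; exact hm (by rw [if_neg h, ite_self])
        exact Finset.mem_Icc.2 ⟨by omega, by omega⟩
    rw [h1, h2, Finset.mul_sum, ← Finset.sum_sub_distrib, ← Finset.sum_neg_distrib]
    refine Finset.sum_congr rfl fun m hm => ?_
    have := Finset.mem_Icc.1 hm
    rw [walkEntry, crossingFactor, if_neg (c := _ ∨ _) (by omega)]
    ring

theorem constEntry_eq (k : ℤ) : constEntry P k = -walkEntry P 0 k := by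
  rw [constEntry, walkEntry, crossingFactor, if_neg (c := _ ∨ _) (by omega), zero_sub]
  simp only [eq_comm (a := (0 : ℤ))]
  ring

/-- Identifies the combination of the columns with the residual of `x` in the recurrence. -/
theorem sum_walkEntry_mul (x : ℤ → Ambient)
    (hx : ∀ k, ¬ (-(maxUp P : ℤ) ≤ k ∧ k ≤ maxDown P) → x k = 0) (m : ℤ) :
    ∑ k ∈ Finset.Icc (-(maxUp P : ℤ)) (maxDown P), walkEntry P m k * x k =
      embed zVar * ∑ i ∈ P.coeff.support, algebraMap ℂ Ambient (P.coeff i) *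
        crossingFactor (embed qVar) (m - i) m * x (m - i) - x m := by
  simp only [walkEntry, sub_mul, Finset.sum_sub_distrib, mul_assoc, ← Finset.mul_sum]
  refine congrArg₂ (· - ·) (congrArg (embed zVar * ·) ?_) ?_
  · rw [sum_coeff_sub P (algebraMap ℂ Ambient)
      (fun k => crossingFactor (embed qVar) k m * x k)]
    refine Finset.sum_congr rfl fun i _ => ?_
    split_ifs with h
    · rfl
    · rw [hx _ (by simpa using h), mul_zero, mul_zero]
  · simp only [ite_mul, one_mul, zero_mul, Finset.sum_ite_eq]
    split_ifs with h
    · rfl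
    · rw [hx _ (by simpa using h)]

variable {P} {u : Fin (maxDown P) → HahnSeries ℚ ℂ} {v : Fin (maxUp P) → HahnSeries ℚ ℂ}

theorem one_sub_z_mul_ne_zero (a : ℂ) : 1 - embed zVar * algebraMap ℂ Ambient a ≠ 0 := by
  rw [embed_zVar, algebraMap_ambient]
  exact one_sub_single_mul_C_ne_zero _

theorem IsKernelRoots.equation_embedRoot (h : IsKernelRoots P u v)
    (a : Fin (maxDown P) ⊕ Fin (maxUp P)) :
    embed zVar * ∑ i ∈ P.coeff.support, algebraMap ℂ Ambient (P.coeff i) *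
      embedRoot (Sum.elim u v a) ^ i = 1 := by
  have := congrArg embedRootHom (h.equation a)
  simp only [map_mul, map_sum, map_zpow₀, map_one, embedRootHom_z, embedRootHom_C] at this
  exact this

/-- A solution of the system with right-hand side `ρ` times `systemRhs P` extends to a bounded
solution on `ℤ` of the recurrence of the walks with source `ρ`. -/
theorem IsKernelRoots.exists_extension (h : IsKernelRoots P u v) (ρ : Ambient)
    (x : Finset.Icc (-(maxUp P : ℤ)) (maxDown P : ℤ) → Ambient)
    (hx : (systemMatrix P u v).mulVec x = fun a => ρ * systemRhs P a) :
    ∃ y : ℤ → Ambient, IsBoundedFamily y ∧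
      (∀ k : Finset.Icc (-(maxUp P : ℤ)) (maxDown P : ℤ), y k = x k) ∧
      ∀ m, y m = (if m = 0 then ρ else 0) + embed zVar * ∑ i ∈ P.coeff.support,
        algebraMap ℂ Ambient (P.coeff i) * crossingFactor (embed qVar) (m - i) m * y (m - i) := by
  let X : ℤ → Ambient := fun k =>
    if hk : k ∈ Finset.Icc (-(maxUp P : ℤ)) (maxDown P) then x ⟨k, hk⟩ else 0
  have hX0 : ∀ k, ¬ (-(maxUp P : ℤ) ≤ k ∧ k ≤ maxDown P) → X k = 0 := fun k hk =>
    dif_neg fun h => hk (Finset.mem_Icc.1 h)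
  have hX : ∀ k : Finset.Icc (-(maxUp P : ℤ)) (maxDown P : ℤ), X k = x k := fun k => dif_pos k.2
  have hsum (f : ℤ → Ambient) : ∑ k : Finset.Icc (-(maxUp P : ℤ)) (maxDown P : ℤ), f k.1 * x k =
      ∑ k ∈ Finset.Icc (-(maxUp P : ℤ)) (maxDown P), f k * X k := by
    rw [← Finset.sum_coe_sort (Finset.Icc (-(maxUp P : ℤ)) (maxDown P)) fun k => f k * X k]
    exact Finset.sum_congr rfl fun k _ => by rw [hX]
  let e : ℤ → Ambient := fun m =>
    ∑ k ∈ Finset.Icc (-(maxUp P : ℤ)) (maxDown P), walkEntry P m k * X k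
  have hrow (E : ℤ → Ambient) (g : ℤ → ℤ) (t : Ambient) (hE : ∀ k, -(maxUp P : ℤ) ≤ k →
      k ≤ maxDown P → E k = ∑ m ∈ Finset.Icc 1 (maxDown P + maxUp P : ℤ),
        walkEntry P (g m) k * t ^ g m) :
      ∑ k ∈ Finset.Icc (-(maxUp P : ℤ)) (maxDown P), E k * X k =
        ∑ m ∈ Finset.Icc 1 (maxDown P + maxUp P : ℤ), e (g m) * t ^ g m := by
    simp only [e, Finset.sum_mul]
    rw [Finset.sum_comm]
    refine Finset.sum_congr rfl fun k hk => ?_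
    rw [hE k (Finset.mem_Icc.1 hk).1 (Finset.mem_Icc.1 hk).2, Finset.sum_mul]
    exact Finset.sum_congr rfl fun m _ => by ring
  have hmul (a) : (systemMatrix P u v).mulVec x a = ρ * systemRhs P a := congrFun hx a
  have hsmall (i) : ∑ m ∈ Finset.Icc 1 (maxDown P + maxUp P : ℤ),
      e m * embedRoot (u i) ^ m = 0 := by
    have h1 := hmul (Sum.inl i)
    rw [systemRhs, mul_zero] at h1
    exact ((hrow (smallEntry P (embedRoot (u i))) id _ fun k => smallEntry_eq_sum P _).symm.trans
      (hsum (smallEntry P (embedRoot (u i)))).symm).trans h1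
  have hlarge (j) : ∑ m ∈ Finset.Icc 1 (maxDown P + maxUp P : ℤ),
      e (-m) * embedRoot (v j) ^ (-m) = 0 := by
    have h1 := hmul (Sum.inr (Sum.inl j))
    rw [systemRhs, mul_zero] at h1
    exact ((hrow (largeEntry P (embedRoot (v j))) (fun m => -m) _
      fun k => largeEntry_eq_sum P _).symm.trans
      (hsum (largeEntry P (embedRoot (v j)))).symm).trans h1
  -- The `[u^0]` equation fixes the residual at altitude `0`, where no correction is added; it
  -- becomes the source term.
  have hzero : -e 0 = ρ := by
    have h1 := hmul (Sum.inr (Sum.inr ()))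
    rw [systemRhs, mul_one] at h1
    rw [← h1, ← Finset.sum_neg_distrib]
    refine Eq.trans ?_ (hsum (constEntry P)).symm
    exact Finset.sum_congr rfl fun k _ => by rw [constEntry_eq]; ring
  obtain ⟨y, hyb, hyx, hy⟩ := exists_bounded_extension (z := embed zVar)
    (p := fun i => algebraMap ℂ Ambient (P.coeff i)) (I := P.coeff.support)
    (c := maxDown P) (d := maxUp P)
    (fun i hi => neg_maxDown_le (Finsupp.mem_support_iff.1 hi))
    (fun i hi => le_maxUp (Finsupp.mem_support_iff.1 hi))
    (fun i hi => by rw [Finsupp.notMem_support_iff.1 hi, map_zero]) (one_sub_z_mul_ne_zero _)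
    (fun a => embedRoot (Sum.elim u v a))
    (fun a b hab => h.injective (embedRootHom.injective hab))
    (fun a => (map_ne_zero embedRootHom).2 (h.ne_zero a)) h.equation_embedRoot
    (fun i => by rw [orderTop_embedRoot]; exact (h.small i).le)
    (fun j => orderTop_inv_nonneg (by rw [orderTop_embedRoot]; exact h.large j))
    (embed qVar) X e hX0 (sum_walkEntry_mul P X hX0) hsmall hlarge
  refine ⟨y, hyb, fun k => ?_, fun m => ?_⟩
  · rw [hyx k (Finset.mem_Icc.1 k.2).1 (Finset.mem_Icc.1 k.2).2, hX]
  · rw [← hzero]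
    exact hy m

theorem orderTop_crossingFactor_nonneg (a b : ℤ) :
    0 ≤ (crossingFactor (embed qVar) a b).orderTop := by
  unfold crossingFactor
  split_ifs
  · exact orderTop_embed_nonneg _
  · exact HahnSeries.orderTop_one.ge

/-- The recurrence of the walks with source `ρ` has at most one bounded solution on `ℤ`. -/
theorem eq_of_recurrence (ρ : Ambient) {y y' : ℤ → Ambient} (hb : IsBoundedFamily y)
    (hb' : IsBoundedFamily y')
    (hy : ∀ m, y m = (if m = 0 then ρ else 0) + embed zVar * ∑ i ∈ P.coeff.support,
        algebraMap ℂ Ambient (P.coeff i) * crossingFactor (embed qVar) (m - i) m * y (m - i))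
    (hy' : ∀ m, y' m = (if m = 0 then ρ else 0) + embed zVar * ∑ i ∈ P.coeff.support,
        algebraMap ℂ Ambient (P.coeff i) * crossingFactor (embed qVar) (m - i) m * y' (m - i))
    (m : ℤ) : y m = y' m :=
  hb.eq_of_contracting hb' one_le_orderTop_zVar P.coeff.support
    (fun m i => algebraMap ℂ Ambient (P.coeff i) * crossingFactor (embed qVar) (m - i) m)
    (fun m i => by
      rw [HahnSeries.orderTop_mul]
      exact add_nonneg (orderTop_algebraMap_nonneg _) (orderTop_crossingFactor_nonneg _ _))
    (fun m i => m - i) _ hy hy' m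

/-- A vector in the null space extends to a bounded solution of the recurrence without source, and
the zero family is the only one. -/
theorem IsKernelRoots.mulVec_injective (h : IsKernelRoots P u v) :
    Function.Injective (systemMatrix P u v).mulVec := by
  refine (injective_iff_map_eq_zero (systemMatrix P u v).mulVecLin).2 fun x hx => ?_
  obtain ⟨y, hyb, hyx, hy⟩ := h.exists_extension 0 x (hx.trans (funext fun a => (zero_mul _).symm))
  ext1 k
  rw [← hyx k, eq_of_recurrence (P := P) (y' := fun _ => 0) 0 hyb ⟨0, fun _ => by simp⟩ hy
    fun m => by simp]
  rfl

theorem card_system : Fintype.card (Fin (maxDown P) ⊕ Fin (maxUp P) ⊕ Unit) =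
    Fintype.card (Finset.Icc (-(maxUp P : ℤ)) (maxDown P : ℤ)) := by
  simp
  omega

/-- The equations are not verified by substituting the roots. Invertibility provides some solution,
its extension to ℤ is a bounded solution with source `1`, and by uniqueness that extension is the
family of the `W_k`. -/
theorem IsKernelRoots.mulVec_altitudeSeries (h : IsKernelRoots P u v) :
    (systemMatrix P u v).mulVec (fun k => altitudeSeries P k) = systemRhs P := by
  obtain ⟨x, hx⟩ := mulVec_surjective_of_injective h.mulVec_injective card_system (systemRhs P)
  obtain ⟨y, hyb, hyx, hy⟩ := h.exists_extension 1 x (hx.trans (funext fun a => (one_mul _).symm))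
  have h1 : ∀ m, y m = altitudeSeries P m :=
    eq_of_recurrence 1 hyb ⟨0, fun k => orderTop_embed_nonneg _⟩ hy (altitudeSeries_eq P)
  have h2 : (fun k : Finset.Icc (-(maxUp P : ℤ)) (maxDown P : ℤ) => altitudeSeries P k) = x := by
    ext1 k
    rw [← hyx k]
    exact (h1 k).symm
  rw [h2, hx]

theorem IsKernelRoots.rank_systemMatrix (h : IsKernelRoots P u v) :
    (systemMatrix P u v).rank = maxDown P + maxUp P + 1 := by
  have h1 : Function.Injective (systemMatrix P u v).mulVecLin := h.mulVec_injective
  rw [Matrix.rank, LinearMap.finrank_range_of_inj h1, Module.finrank_pi, ← card_system]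
  simp
  omega

end System

/-! ### Rationality in the roots -/

section Rational

variable {P : ℂ[T;T⁻¹]} {u : Fin (maxDown P) → HahnSeries ℚ ℂ} {v : Fin (maxUp P) → HahnSeries ℚ ℂ}

theorem mem_of_mul_mem {k F : Type*} [Field k] [Field F] [Algebra k F] (S : IntermediateField k F)
    {a x : F} (h0 : a ≠ 0) (ha : a ∈ S) (hx : a * x ∈ S) : x ∈ S := by
  rw [← inv_mul_cancel_left₀ h0 x]
  exact mul_mem (inv_mem ha) hx

theorem map_mem_of_linear_equation {k F R ι : Type*} [Field k] [Field F] [Algebra k F] [CommRing R]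
    (S : IntermediateField k F) (φ : R →+* F) {z q p w : R} {s t : Finset ι} {f g : ι → R}
    (h : (1 - z * p) * w = 1 - z * (1 - q) * (∑ i ∈ s, f i + ∑ i ∈ t, g i))
    (h0 : φ (1 - z * p) ≠ 0) (hz : φ z ∈ S) (hq : φ q ∈ S) (hp : φ p ∈ S)
    (hf : ∀ i, φ (f i) ∈ S) (hg : ∀ i, φ (g i) ∈ S) : φ w ∈ S := by
  refine mem_of_mul_mem S h0 ?_ ?_
  · rw [map_sub, map_one, map_mul]
    exact sub_mem (one_mem S) (mul_mem hz hp)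
  · rw [← map_mul, h, map_sub, map_mul, map_mul, map_sub, map_one, map_add, map_sum, map_sum]
    exact sub_mem (one_mem S) (mul_mem (mul_mem hz (sub_mem (one_mem S) hq))
      (add_mem (sum_mem fun i _ => hf i) (sum_mem fun i _ => hg i)))

/-- Elements algebraic over `A` are closed under field operations, so algebraic generators give an
algebraic field. The relation found in `F` holds already in `R` because `φ` is injective. -/
theorem exists_eval₂_eq_zero {k A R F : Type*} [Field k] [CommRing A] [IsDomain A] [CommRing R]
    [Field F] [Algebra k F] {ψ : A →+* R} {φ : R →+* F} (hφ : Function.Injective φ) {s : Set F}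
    (hs : ∀ x ∈ s, (∃ a, φ (ψ a) = x) ∨ ∃ f : Polynomial A, f.map (φ.comp ψ) ≠ 0 ∧
      (f.map (φ.comp ψ)).eval x = 0)
    (hk : ∀ a : k, ∃ b, φ (ψ b) = algebraMap k F a) {w : R}
    (hw : φ w ∈ IntermediateField.adjoin k s) :
    ∃ f : Polynomial A, f ≠ 0 ∧ f.eval₂ ψ w = 0 := by
  let : Algebra A F := (φ.comp ψ).toAlgebra
  have key : ∀ x ∈ IntermediateField.adjoin k s, IsAlgebraic A x := by
    intro x hx
    induction hx using IntermediateField.adjoin_induction with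
    | mem x hx =>
      obtain ⟨a, rfl⟩ | ⟨f, h0, hf⟩ := hs x hx
      · exact isAlgebraic_algebraMap a
      · refine ⟨f, fun h => h0 (by rw [h, Polynomial.map_zero]), ?_⟩
        rwa [Polynomial.aeval_def, ← Polynomial.eval_map]
    | algebraMap a =>
      obtain ⟨b, hb⟩ := hk a
      rw [← hb]
      exact isAlgebraic_algebraMap b
    | add x y _ _ hx hy => exact hx.add hy
    | inv x _ hx => exact hx.inv
    | mul x y _ _ hx hy => exact hx.mul hy
  obtain ⟨f, h0, hf⟩ := key _ hw
  refine ⟨f, h0, hφ ?_⟩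
  rw [Polynomial.hom_eval₂, map_zero]
  exact hf

theorem evalAt_mem (S : IntermediateField ℂ Ambient) {x : Ambient} (hx : x ∈ S) (f : ℂ[T;T⁻¹]) :
    evalAt x f ∈ S :=
  sum_mem fun _ _ => mul_mem (S.algebraMap_mem _) (zpow_mem hx _)

theorem systemMatrix_mem (S : IntermediateField ℂ Ambient) (hz : embed zVar ∈ S)
    (hq : embed qVar ∈ S) (hu : ∀ i, embedRoot (u i) ∈ S) (hv : ∀ j, embedRoot (v j) ∈ S) (a k) :
    systemMatrix P u v a k ∈ S := by
  rcases a with i | j | _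
  · change smallEntry P (embedRoot (u i)) k ∈ S
    unfold smallEntry
    split_ifs
    · exact mul_mem (mul_mem hz hq) (evalAt_mem S (hu i) _)
    · exact mul_mem hz (evalAt_mem S (hu i) _)
    · exact S.neg_mem (S.sub_mem (evalAt_mem S (hu i) _) (mul_mem hz (evalAt_mem S (hu i) _)))
  · change largeEntry P (embedRoot (v j)) k ∈ S
    unfold largeEntry
    split_ifs
    · exact mul_mem (mul_mem hz hq) (evalAt_mem S (hv j) _)
    · exact mul_mem hz (evalAt_mem S (hv j) _)
    · exact S.neg_mem (S.sub_mem (evalAt_mem S (hv j) _) (mul_mem hz (evalAt_mem S (hv j) _)))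
  · change constEntry P k ∈ S
    unfold constEntry
    refine S.sub_mem ?_ (mul_mem hz (S.algebraMap_mem _))
    split_ifs
    · exact one_mem S
    · exact zero_mem S

/-- The linear system handles `-d ≤ k ≤ c`. Outside this window the recurrence is run upwards, and
downwards after the reflection `k ↦ -k`. -/
theorem IsKernelRoots.altitudeSeries_mem (h : IsKernelRoots P u v)
    (S : IntermediateField ℂ Ambient) (hz : embed zVar ∈ S) (hq : embed qVar ∈ S)
    (hu : ∀ i, embedRoot (u i) ∈ S) (hv : ∀ j, embedRoot (v j) ∈ S) (k : ℤ) :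
    altitudeSeries P k ∈ S := by
  have hbase : ∀ k, -(maxUp P : ℤ) ≤ k → k ≤ maxDown P → altitudeSeries P k ∈ S := fun k hk hk' =>
    mem_of_mulVec_eq S _ (systemMatrix_mem S hz hq hu hv) h.mulVec_injective card_system
      (systemRhs P) (fun a => by
        rcases a with i | j | _
        · exact zero_mem S
        · exact zero_mem S
        · exact one_mem S) _ h.mulVec_altitudeSeries ⟨k, Finset.mem_Icc.2 ⟨hk, hk'⟩⟩
  have hz0 : embed zVar ≠ 0 := by
    rw [embed_zVar]
    exact HahnSeries.single_ne_zero one_ne_zero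
  have hw (a b : ℤ) : crossingFactor (embed qVar) a b ∈ S := by
    unfold crossingFactor
    split_ifs
    · exact hq
    · exact one_mem S
  have hne {i : ℤ} (hi : P.coeff i ≠ 0) : embed zVar * algebraMap ℂ Ambient (P.coeff i) ≠ 0 :=
    mul_ne_zero hz0 ((map_ne_zero _).2 hi)
  rcases le_total (-(maxUp P : ℤ)) k with hk | hk
  · refine mem_of_recurrence S (z := embed zVar) (p := fun i => algebraMap ℂ Ambient (P.coeff i))
      (I := P.coeff.support) (c := maxDown P) (d := maxUp P)
      (fun i hi => neg_maxDown_le (Finsupp.mem_support_iff.1 hi))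
      (fun i hi => le_maxUp (Finsupp.mem_support_iff.1 hi))
      (fun i hi => by rw [Finsupp.notMem_support_iff.1 hi, map_zero]) hz
      (fun i => S.algebraMap_mem _) (fun _ => one_sub_z_mul_ne_zero _)
      (fun hc => hne (coeff_neg_maxDown_ne_zero hc))
      (fun i m => crossingFactor (embed qVar) (m - i) m) (fun i m => hw _ _)
      (fun i m hm hi => by rw [crossingFactor, if_neg (by omega)]) (altitudeSeries P)
      (fun m hm => ?_) hbase k hk
    rw [altitudeSeries_eq P m, if_neg hm.ne', zero_add]
  · have hneg (f : ℤ → Ambient) :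
        ∑ i ∈ P.coeff.support.image (fun i => -i), f i = ∑ i ∈ P.coeff.support, f (-i) :=
      Finset.sum_image fun i _ j _ hij => neg_injective hij
    have hmem {i : ℤ} : i ∈ P.coeff.support.image (fun i => -i) ↔ -i ∈ P.coeff.support := by
      simp only [Finset.mem_image, neg_eq_iff_eq_neg, exists_eq_right]
    have h1 := mem_of_recurrence S (z := embed zVar)
      (p := fun i => algebraMap ℂ Ambient (P.coeff (-i)))
      (I := P.coeff.support.image fun i => -i) (c := maxUp P) (d := maxDown P)
      (fun i hi => by
        have := le_maxUp (Finsupp.mem_support_iff.1 (hmem.1 hi))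
        omega)
      (fun i hi => by
        have := neg_maxDown_le (Finsupp.mem_support_iff.1 (hmem.1 hi))
        omega)
      (fun i hi => by rw [Finsupp.notMem_support_iff.1 (fun h => hi (hmem.2 h)), map_zero]) hz
      (fun i => S.algebraMap_mem _) (fun _ => one_sub_z_mul_ne_zero _)
      (fun hc => by rw [neg_neg]; exact hne (coeff_maxUp_ne_zero hc))
      (fun i m => crossingFactor (embed qVar) (-(m - i)) (-m)) (fun i m => hw _ _)
      (fun i m hm hi => by rw [crossingFactor, if_neg (by omega)])
      (fun k => altitudeSeries P (-k)) (fun m hm => ?_)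
      (fun k hk hk' => hbase (-k) (by omega) (by omega)) (-k) (by omega)
    · rwa [neg_neg] at h1
    · rw [altitudeSeries_eq P (-m), if_neg (by omega), zero_add, hneg]
      simp only [neg_neg, sub_neg_eq_add, neg_add, ← sub_eq_add_neg]

theorem embed_T_mem (S : IntermediateField ℂ Ambient) (hu : embed uVar ∈ S) (n : ℤ) :
    embed (PowerSeries.C (LaurentPolynomial.T n)) ∈ S := by
  have hnat (n : ℕ) : embed (PowerSeries.C (LaurentPolynomial.T n)) ∈ S := by
    have : (LaurentPolynomial.T n : Coeffs) = LaurentPolynomial.T 1 ^ n := by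
      rw [LaurentPolynomial.T_pow, mul_one]
    rw [this, map_pow, map_pow]
    exact pow_mem hu n
  obtain ⟨n, rfl | rfl⟩ := n.eq_nat_or_neg
  · exact hnat n
  · have h1 : embed (PowerSeries.C (LaurentPolynomial.T (-(n : ℤ)))) *
        embed (PowerSeries.C (LaurentPolynomial.T (n : ℤ))) = 1 := by
      rw [← map_mul, ← map_mul, ← LaurentPolynomial.T_add, neg_add_cancel,
        LaurentPolynomial.T_zero, map_one, map_one]
    have h2 : embed (PowerSeries.C (LaurentPolynomial.T (n : ℤ))) ≠ 0 := by
      intro h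
      rw [h, mul_zero] at h1
      exact zero_ne_one h1
    exact mem_of_mul_mem S h2 (hnat n) (by rw [mul_comm, h1]; exact one_mem S)

theorem embed_ofLaurent_mem (S : IntermediateField ℂ Ambient) (hu : embed uVar ∈ S)
    (f : ℂ[T;T⁻¹]) : embed (ofLaurent f) ∈ S := by
  rw [ofLaurent, Finsupp.sum, map_sum, map_sum]
  refine sum_mem fun n _ => ?_
  rw [map_mul, map_mul, embed_C_C]
  exact mul_mem (S.algebraMap_mem _) (embed_T_mem S hu n)

theorem embed_walkGF_mem (S : IntermediateField ℂ Ambient) (hz : embed zVar ∈ S)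
    (hu : embed uVar ∈ S) (hq : embed qVar ∈ S) (hW : ∀ k, altitudeSeries P k ∈ S) :
    embed (walkGF P) ∈ S := by
  -- The constant term in `z` is `1`, so the functional equation can be divided by `1 - zP`.
  have hne : embed (1 - zVar * ofLaurent P) ≠ 0 := by
    intro h
    have h1 := congrArg PowerSeries.constantCoeff (embed_injective (h.trans (map_zero _).symm))
    simp [zVar] at h1
  have hf (f : ℂ[T;T⁻¹]) (k : ℤ) : embed (ofLaurent f * inclAltitude (altitudeGF P k)) ∈ S := by
    rw [map_mul]
    exact mul_mem (embed_ofLaurent_mem S hu _) (hW k)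
  exact map_mem_of_linear_equation S embed (functional_equation P) hne hz hq
    (embed_ofLaurent_mem S hu P) (fun k => hf _ k) (fun k => hf _ k)

/-- The substitution of `z`, `u`, `q` for the variables. -/
def evalVars : MvPolynomial (Fin 3) ℂ →+* PowerSeries Coeffs :=
  MvPolynomial.eval₂Hom (algebraMap ℂ (PowerSeries Coeffs)) ![zVar, uVar, qVar]

theorem embed_evalVars_C (a : ℂ) :
    embed (evalVars (MvPolynomial.C a)) = algebraMap ℂ Ambient a := by
  rw [evalVars, MvPolynomial.eval₂Hom_C, PowerSeries.algebraMap_apply]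
  exact embed_C_C a

/-- The kernel itself has coefficients in `ℂ[z]`, so it is the polynomial that shows each root to be
algebraic. -/
theorem IsKernelRoots.exists_poly_root (h : IsKernelRoots P u v)
    (a : Fin (maxDown P) ⊕ Fin (maxUp P)) :
    ∃ f : Polynomial (MvPolynomial (Fin 3) ℂ), f.map (embed.comp evalVars) ≠ 0 ∧
      (f.map (embed.comp evalVars)).eval (embedRoot (Sum.elim u v a)) = 0 := by
  have hIc : ∀ i ∈ P.coeff.support, -(maxDown P : ℤ) ≤ i := fun i hi =>
    neg_maxDown_le (Finsupp.mem_support_iff.1 hi)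
  have hX : embed (evalVars (MvPolynomial.X 0)) = embed zVar := by
    rw [evalVars, MvPolynomial.eval₂Hom_X']
    rfl
  have hf : (Polynomial.X ^ maxDown P - Polynomial.C (MvPolynomial.X 0) *
      ∑ i ∈ P.coeff.support, Polynomial.C (MvPolynomial.C (P.coeff i)) *
        Polynomial.X ^ (i + (maxDown P : ℤ)).toNat : Polynomial (MvPolynomial (Fin 3) ℂ)).map
      (embed.comp evalVars) = kernelPoly (embed zVar)
        (fun i => algebraMap ℂ Ambient (P.coeff i)) P.coeff.support (maxDown P) := by
    simp only [kernelPoly, Polynomial.map_sub, Polynomial.map_mul, Polynomial.map_pow,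
      Polynomial.map_X, Polynomial.map_C, Polynomial.map_sum, RingHom.comp_apply, hX,
      embed_evalVars_C]
  refine ⟨_, by
    rw [hf]
    exact kernelPoly_ne_zero hIc
      (fun i hi => by rw [Finsupp.notMem_support_iff.1 hi, map_zero]) (one_sub_z_mul_ne_zero _), ?_⟩
  rw [hf]
  exact (eval_kernelPoly_eq_zero_iff hIc ((map_ne_zero embedRootHom).2 (h.ne_zero a))).2
    (h.equation_embedRoot a)

theorem IsKernelRoots.embed_walkGF_mem_adjoin (h : IsKernelRoots P u v) :
    embed (walkGF P) ∈
      IntermediateField.adjoin ℂ ({embed zVar, embed uVar, embed qVar} ∪ rootSet P u v) := by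
  have hS {x : Ambient}
      (hx : x ∈ ({embed zVar, embed uVar, embed qVar} ∪ rootSet P u v : Set Ambient)) :
      x ∈ IntermediateField.adjoin ℂ
        ({embed zVar, embed uVar, embed qVar} ∪ rootSet P u v : Set Ambient) :=
    IntermediateField.subset_adjoin _ _ hx
  have hz := hS (x := embed zVar) (by simp)
  have hq := hS (x := embed qVar) (by simp)
  exact embed_walkGF_mem _ hz (hS (by simp)) hq
    (h.altitudeSeries_mem _ hz hq (fun i => hS (Or.inr (Or.inl ⟨i, rfl⟩)))
      fun j => hS (Or.inr (Or.inr ⟨j, rfl⟩)))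

theorem IsKernelRoots.exists_eval₂_evalVars_eq_zero (h : IsKernelRoots P u v) :
    ∃ F : Polynomial (MvPolynomial (Fin 3) ℂ), F ≠ 0 ∧ F.eval₂ evalVars (walkGF P) = 0 := by
  have hvar (i : Fin 3) :
      embed (evalVars (MvPolynomial.X i)) = embed (![zVar, uVar, qVar] i) := by
    rw [evalVars, MvPolynomial.eval₂Hom_X']
  have hgen : ∀ x ∈ ({embed zVar, embed uVar, embed qVar} ∪ rootSet P u v : Set Ambient),
      (∃ a, embed (evalVars a) = x) ∨ ∃ f : Polynomial (MvPolynomial (Fin 3) ℂ),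
        f.map (embed.comp evalVars) ≠ 0 ∧ (f.map (embed.comp evalVars)).eval x = 0 := by
    rintro x ((rfl | rfl | rfl) | ⟨i, rfl⟩ | ⟨j, rfl⟩)
    · exact Or.inl ⟨_, hvar 0⟩
    · exact Or.inl ⟨_, hvar 1⟩
    · exact Or.inl ⟨_, hvar 2⟩
    · exact Or.inr (h.exists_poly_root (Sum.inl i))
    · exact Or.inr (h.exists_poly_root (Sum.inr j))
  exact exists_eval₂_eq_zero embed_injective hgen (fun a => ⟨_, embed_evalVars_C a⟩)
    h.embed_walkGF_mem_adjoin

end Rational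

end LatticePath

end

open LatticePath in
theorem theorem1 (P : LaurentPolynomial ℂ) :
    -- `W` is algebraic over `ℂ(z,u,q)`
    (∃ F : Polynomial (MvPolynomial (Fin 3) ℂ), F ≠ 0 ∧
      F.eval₂ (MvPolynomial.eval₂Hom (algebraMap ℂ (PowerSeries Coeffs)) ![zVar, uVar, qVar])
        (walkGF P) = 0) ∧
    -- `W` in terms of the `W_k` with `-d < k < c`
    ((1 - zVar * ofLaurent P) * walkGF P =
      1 - zVar * (1 - qVar) *
        (∑ k ∈ Finset.Ioo (-(maxUp P : ℤ)) 0,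
            ofLaurent (posPart (P * LaurentPolynomial.T k)) * inclAltitude (altitudeGF P k) +
          ∑ k ∈ Finset.Ioo 0 (maxDown P : ℤ),
            ofLaurent (negPart (P * LaurentPolynomial.T k)) * inclAltitude (altitudeGF P k))) ∧
    -- the kernel has `c` small roots, `d` large roots and no others
    (∃ u v, IsKernelRoots P u v) ∧
    ∀ u v, IsKernelRoots P u v →
      -- the linear system has full rank, and its solution is `W_{-d}, …, W_c`
      (systemMatrix P u v).rank = maxDown P + maxUp P + 1 ∧
      (∀ x : Finset.Icc (-(maxUp P : ℤ)) (maxDown P : ℤ) → Ambient,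
        (systemMatrix P u v).mulVec x = systemRhs P ↔ ∀ k, x k = altitudeSeries P k) ∧
      -- each `W_k` is a rational function of `z`, `q` and the roots
      (∀ k : ℤ, altitudeSeries P k ∈
        IntermediateField.adjoin ℂ ({embed zVar, embed qVar} ∪ rootSet P u v)) ∧
      -- `W` is a rational function of `z`, `u`, `q` and the roots
      embed (walkGF P) ∈
        IntermediateField.adjoin ℂ ({embed zVar, embed uVar, embed qVar} ∪ rootSet P u v) := by
  obtain ⟨u₀, v₀, h₀, -⟩ := exists_isKernelRoots P
  refine ⟨h₀.exists_eval₂_evalVars_eq_zero, functional_equation P, ⟨u₀, v₀, h₀⟩, fun u v h =>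
    ⟨h.rank_systemMatrix, fun x => ⟨fun hx k => ?_, fun hx => ?_⟩, ?_, ?_⟩⟩
  · exact congrFun (h.mulVec_injective (hx.trans h.mulVec_altitudeSeries.symm)) k
  · rw [funext hx, h.mulVec_altitudeSeries]
  · have hS {x : Ambient} (hx : x ∈ ({embed zVar, embed qVar} ∪ rootSet P u v : Set Ambient)) :
        x ∈ IntermediateField.adjoin ℂ ({embed zVar, embed qVar} ∪ rootSet P u v : Set Ambient) :=
      IntermediateField.subset_adjoin _ _ hx
    exact h.altitudeSeries_mem _ (hS (by simp)) (hS (by simp))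
      (fun i => hS (Or.inr (Or.inl ⟨i, rfl⟩))) fun j => hS (Or.inr (Or.inr ⟨j, rfl⟩))
  · exact h.embed_walkGF_mem_adjoin
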